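/- **Conventions.** A *pasture* $F$ consists of an abelian group $F^\times$ (written multiplicatively) and an ideal $N_F$ of the semiring $\mathbb N[F^\times]$ such that $1\notin N_F$ and there is a unique $\epsilon\in F^\times$ with $1+\epsilon\in N_F$. We write $F=F^\times\cup\{0\}$, and $0\le\sum a_i$ for $\sum a_i\in N_F$. A *morphism* $F\to F'$ of pastures is a group homomorphism $F^\times\to F'^\times$ whose linear extension maps $N_F$ into $N_{F'}$. An element $a\in F$ is *fundamental* if $0\le a+b+\epsilon^i$ for some $b\in F$ and $i\in\{0,1\}$; the *foundation of $F$* is the subpasture whose underlying monoid is generated by the fundamental elements, with the restricted nullset. Let $E$ be a finite totally ordered set, $M$ a matroid of rank $r$ on $E$ and $F$ a pasture. A *weak Grassmann–Plücker function over $F$ representing $M$* is a function $\Delta:\binom Er\to F$ with $\Delta(J)\ne0$ if and only if $J$ is a basis of $M$, and $$0\le \Delta(I_{1,2})\Delta(I_{3,4})+\epsilon\,\Delta(I_{1,3})\Delta(I_{2,4})+\Delta(I_{1,4})\Delta(I_{2,3}),\qquad I_{k,l}=I\cup\{i_k,i_l\},$$ for every $(r-2)$-subset $I$ of $E$ and all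 $i_1<i_2<i_3<i_4$ in $E\setminus I$. Its class $[\Delta]$ up to multiplication by elements of $F^\times$ is a *weak $F$-matroid* over $M$. The torus $T(F)=(F^\times)^E$ acts by $t.[\Delta]=[t.\Delta]$ with $(t.\Delta)(J)=\prod_{j\in J}t(j)\cdot\Delta(J)$; its orbits are the *rescaling classes*, and $\mathcal X^f_M(F)$ denotes the set of rescaling classes of weak $F$-matroids over $M$. Two functions $\Delta,\Delta'$ are *rescaling equivalent* if $[\Delta]$ and $[\Delta']$ lie in the same rescaling class. Let $\Omega_M$ be the set of tuples $(I,i_1,i_2,i_3,i_4)\in\binom E{r-2}\times E^4$ for which $I_{1,2},I_{2,3},I_{3,4},I_{4,1}$ are bases of $M$. The *cross ratio function* $\mathrm{Cr}_\Delta:\Omega_M\to F^\times$ sends it to $\dfrac{\Delta(I_{1,2})\Delta(I_{3,4})}{\Delta(I_{2,3})\Delta(I_{4,1})}$. The *weak universal pasture* $k_M^w$ is constructed as follows. Let $G$ be the group of Laurent monomials $\epsilon^i\prod x_B^{e_B}$ in variables $x_B$, one for each basis $B$ of $M$, with $\epsilon^2=1$; let $N\subset\mathbb N[G]$ be the ideal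 generated by $1+\epsilon$ and the 3-term Plücker expressions in the $x_J$, where $x_J=0$ if $J$ is not a basis. Restrict $N$ to the subgroup $G_0$ of monomials of degree $\sum e_B=0$, and identify any two elements of $G_0$ that have a common weak inverse ($a\sim a'$ if $a+b,\,a'+b\in N$ for some $b\in G_0$). The *foundation* $k_M^f$ of $M$ is the foundation of the pasture $k_M^w$. The *characteristic morphism* $\chi_{[\Delta]}:k_M^w\to F$ of $[\Delta]$ sends $\prod x_B^{e_B}$ with $\sum e_B=0$ to $\prod\Delta(B)^{e_B}$. **Theorem.** Let $M$ be a matroid of rank $r$ on $E$. (a) Let $F$ be a pasture and $\Delta,\Delta'$ weak Grassmann–Plücker functions over $F$ representing $M$. The following are equivalent: 1. $\Delta$ and $\Delta'$ are rescaling equivalent; 2. $\mathrm{Cr}_\Delta=\mathrm{Cr}_{\Delta'}$ as functions $\Omega_M\to F^\times$; 3. $\chi_{[\Delta]}|_{k_M^f}=\chi_{[\Delta']}|_{k_M^f}$. (b) For every pasture $F$, the rule $[\Delta]\mapsto\chi_{[\Delta]}|_{k_M^f}$ defines a well-defined bijection $\Phi_F:\mathcal X_M^f(F)\to\mathrm{Hom}(k_M^f,F)$.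 It is functorial in $F$: for every morphism $f:F\to F'$ of pastures, $\Phi_{F'}\circ f_*=f\circ\Phi_F$ (i.e. $\Phi_{F'}(f_*c)=f\circ\Phi_F(c)$ for all $c$), where $f_*$ is induced by $\Delta\mapsto f\circ\Delta$. -/

import Mathlib

universe u v w z

set_option linter.unusedSectionVars false

noncomputable section

/-! ## Formal sums

For an abelian group `G`, the monoid with zero `G ∪ {0}` is `WithZero G`, and `ℕ[G]` is
`MonoidAlgebra ℕ G`. -/

namespace FormalSum

/-- The inclusion `G ∪ {0} → ℕ[G]`. It sends the zero of `G ∪ {0}` to the empty sum. -/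
def inc {G : Type u} [CommGroup G] : WithZero G → MonoidAlgebra ℕ G :=
  WithZero.recZeroCoe 0 (fun g => MonoidAlgebra.of ℕ G g)

/-- The linear extension `ℕ[G] → ℕ[H]` of a group homomorphism `G → H`. -/
abbrev map {G : Type u} {H : Type v} [CommGroup G] [CommGroup H] (f : G →* H) :
    MonoidAlgebra ℕ G →+* MonoidAlgebra ℕ H :=
  MonoidAlgebra.mapDomainRingHom ℕ f

section Lemmas
variable {G : Type u} {H : Type v} [CommGroup G] [CommGroup H]

@[simp] lemma inc_zero : inc (0 : WithZero G) = 0 := rfl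

@[simp] lemma inc_coe (g : G) : inc (g : WithZero G) = MonoidAlgebra.of ℕ G g := rfl

lemma inc_mul (a b : WithZero G) : inc (a * b) = inc a * inc b := by
  induction a using WithZero.recZeroCoe with
  | zero => simp
  | coe a =>
    induction b using WithZero.recZeroCoe with
    | zero => simp
    | coe b => rw [← WithZero.coe_mul, inc_coe, inc_coe, inc_coe, map_mul]

@[simp] lemma map_of (f : G →* H) (g : G) :
    map f (MonoidAlgebra.of ℕ G g) = MonoidAlgebra.of ℕ H (f g) := by
  simp [map, MonoidAlgebra.of]

lemma map_inc (f : G →* H) (a : WithZero G) :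
    map f (inc a) = inc (WithZero.map' f a) := by
  induction a using WithZero.recZeroCoe with
  | zero => simp
  | coe a => rw [inc_coe, map_of, WithZero.map'_coe, inc_coe]

/-- The number of summands of a formal sum. -/
def size : MonoidAlgebra ℕ G →+* ℕ :=
  (MonoidAlgebra.lift ℕ ℕ G (1 : G →* ℕ)).toRingHom

@[simp] lemma size_of (g : G) : size (MonoidAlgebra.of ℕ G g) = 1 := by
  simp [size]

lemma size_inc_of_ne {a : WithZero G} (h : a ≠ 0) : size (inc a) = 1 := by
  induction a using WithZero.recZeroCoe with
  | zero => exact absurd rfl h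
  | coe a => exact size_of a

lemma toMultiset_map (f : G →* H) (z : MonoidAlgebra ℕ G) :
    Finsupp.toMultiset (map f z).coeff = (Finsupp.toMultiset z.coeff).map f := by
  rw [Finsupp.toMultiset_map]; rfl

lemma toMultiset_of (g : G) :
    Finsupp.toMultiset (MonoidAlgebra.of ℕ G g).coeff = {g} := by
  simp [MonoidAlgebra.of]

lemma ext_toMultiset {y z : MonoidAlgebra ℕ G}
    (h : Finsupp.toMultiset y.coeff = Finsupp.toMultiset z.coeff) : y = z :=
  MonoidAlgebra.coeff_injective (by
    classical exact Multiset.toFinsupp.symm.injective h)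

lemma eq_of_of_map_eq (f : G →* H) {z : MonoidAlgebra ℕ G} {x : H}
    (h : map f z = MonoidAlgebra.of ℕ H x) : ∃ a, z = MonoidAlgebra.of ℕ G a := by
  have h1 := toMultiset_map f z
  rw [h, toMultiset_of, eq_comm, Multiset.map_eq_singleton] at h1
  obtain ⟨a, ha, -⟩ := h1
  exact ⟨a, ext_toMultiset (by rw [ha, toMultiset_of])⟩

lemma eq_add_of_map_eq (f : G →* H) {z : MonoidAlgebra ℕ G} {x y : H}
    (h : map f z = MonoidAlgebra.of ℕ H x + MonoidAlgebra.of ℕ H y) :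
    ∃ a b, z = MonoidAlgebra.of ℕ G a + MonoidAlgebra.of ℕ G b ∧ f a = x ∧ f b = y := by
  classical
  have h1 := toMultiset_map f z
  rw [h, MonoidAlgebra.coeff_add, map_add, toMultiset_of, toMultiset_of, eq_comm,
    Multiset.singleton_add] at h1
  obtain ⟨a, ha, hax, hr⟩ := (Multiset.map_eq_cons _ _ _ _).2 h1
  rw [Multiset.map_eq_singleton] at hr
  obtain ⟨b, hb, hby⟩ := hr
  refine ⟨a, b, ext_toMultiset ?_, hax, hby⟩
  rw [MonoidAlgebra.coeff_add, map_add, toMultiset_of, toMultiset_of, ← hb,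
    Multiset.singleton_add, Multiset.cons_erase ha]

end Lemmas

end FormalSum

open FormalSum (inc)

/-! ## Pastures -/

/-- A pasture `F`: an abelian group `Fˣ` together with an ideal of `ℕ[Fˣ]` (the *nullset*, i.e. the
formal sums `∑ aᵢ` with `0 ≤ ∑ aᵢ`) which does not contain `1` and such that there is a unique
`ε ∈ Fˣ` with `0 ≤ 1 + ε`. -/
structure Pasture where
  /-- The unit group `Fˣ`. -/
  Units : Type u
  [commGroup : CommGroup Units]
  /-- The nullset. -/
  null : Ideal (MonoidAlgebra ℕ Units)
  one_notMem : (1 : MonoidAlgebra ℕ Units) ∉ null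
  existsUnique_eps : ∃! e : Units, 1 + MonoidAlgebra.of ℕ Units e ∈ null

attribute [instance] Pasture.commGroup

namespace Pasture

/-- The underlying monoid with zero `F = Fˣ ∪ {0}`. -/
abbrev Elem (F : Pasture.{u}) : Type u := WithZero F.Units

/-- The weak inverse `ε` of `1`. -/
def eps (F : Pasture.{u}) : F.Units := F.existsUnique_eps.choose

lemma one_add_eps (F : Pasture.{u}) : 1 + MonoidAlgebra.of ℕ F.Units F.eps ∈ F.null :=
  F.existsUnique_eps.choose_spec.1

lemma eq_eps (F : Pasture.{u}) {e : F.Units} (h : 1 + MonoidAlgebra.of ℕ F.Units e ∈ F.null) :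
    e = F.eps :=
  F.existsUnique_eps.choose_spec.2 e h

lemma eq_eps_mul (F : Pasture.{u}) {a b : F.Units}
    (h : MonoidAlgebra.of ℕ F.Units a + MonoidAlgebra.of ℕ F.Units b ∈ F.null) :
    b = F.eps * a := by
  have h1 := F.null.mul_mem_left (MonoidAlgebra.of ℕ F.Units a⁻¹) h
  rw [mul_add, ← map_mul, ← map_mul, inv_mul_cancel, map_one] at h1
  rw [← F.eq_eps h1, mul_comm a⁻¹ b, inv_mul_cancel_right]

lemma eps_mul_eps (F : Pasture.{u}) : F.eps * F.eps = 1 := by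
  have h := F.one_add_eps
  rw [add_comm, ← map_one (MonoidAlgebra.of ℕ F.Units)] at h
  exact (F.eq_eps_mul h).symm

/-- A morphism of pastures: a group homomorphism whose linear extension maps the nullset into the
nullset. -/
@[ext] structure Hom (F : Pasture.{u}) (F' : Pasture.{v}) where
  /-- The homomorphism between the unit groups. -/
  onUnits : F.Units →* F'.Units
  map_null : ∀ s ∈ F.null, FormalSum.map onUnits s ∈ F'.null

namespace Hom

variable {F : Pasture.{u}} {F' : Pasture.{v}} {F'' : Pasture.{w}}

/-- The map `F → F'` between the underlying sets of pastures. -/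
def app (f : Hom F F') : F.Elem →*₀ F'.Elem := WithZero.map' f.onUnits

/-- The identity morphism. -/
def id (F : Pasture.{u}) : Hom F F := ⟨MonoidHom.id _, fun s hs => by simpa using hs⟩

/-- The composition `g ∘ f` of morphisms of pastures. -/
def comp (g : Hom F' F'') (f : Hom F F') : Hom F F'' where
  onUnits := g.onUnits.comp f.onUnits
  map_null s hs := by
    rw [FormalSum.map, MonoidAlgebra.mapDomainRingHom_comp]
    exact g.map_null _ (f.map_null s hs)

lemma map_eps (f : Hom F F') : f.onUnits F.eps = F'.eps := by
  apply F'.eq_eps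
  have h := f.map_null _ F.one_add_eps
  rwa [map_add, map_one, FormalSum.map_of] at h

end Hom

/-! ## Fundamental elements and the foundation of a pasture -/

/-- A fundamental element of `F`: an `a ∈ F` such that `0 ≤ a + b + ε ^ i` for some `b ∈ F` and
`i ∈ {0, 1}`. -/
def IsFundamental (F : Pasture.{u}) (a : F.Elem) : Prop :=
  ∃ b : F.Elem, ∃ i : Fin 2,
    inc a + inc b + MonoidAlgebra.of ℕ F.Units (F.eps ^ (i : ℕ)) ∈ F.null

/-- The underlying monoid of the foundation of `F`: the submonoid of `F` that is generated by the
fundamental elements. -/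
def foundationMonoid (F : Pasture.{u}) : Submonoid F.Elem :=
  Submonoid.closure {a | F.IsFundamental a}

lemma isFundamental_zero (F : Pasture.{u}) : F.IsFundamental 0 := by
  refine ⟨(F.eps : F.Units), 0, ?_⟩
  have h := F.one_add_eps
  rw [add_comm, ← map_one (MonoidAlgebra.of ℕ F.Units)] at h
  simpa using h

lemma isFundamental_eps (F : Pasture.{u}) : F.IsFundamental (F.eps : F.Units) := by
  refine ⟨0, 0, ?_⟩
  have h := F.one_add_eps
  rw [add_comm, ← map_one (MonoidAlgebra.of ℕ F.Units)] at h
  simpa using h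

lemma eps_mem_foundationMonoid (F : Pasture.{u}) :
    ((F.eps : F.Units) : F.Elem) ∈ F.foundationMonoid :=
  Submonoid.subset_closure F.isFundamental_eps

lemma inv_mem_foundationMonoid (F : Pasture.{u}) {a : F.Elem} (ha : a ∈ F.foundationMonoid) :
    a⁻¹ ∈ F.foundationMonoid := by
  induction ha using Submonoid.closure_induction with
  | one => rw [inv_one]; exact one_mem _
  | mul x y _ _ hx hy => rw [mul_inv]; exact mul_mem hx hy
  | mem x hx =>
    obtain ⟨b, i, h⟩ := hx
    by_cases h0 : x = 0
    · subst h0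
      rw [inv_zero]
      exact Submonoid.subset_closure F.isFundamental_zero
    · have h1 : F.IsFundamental (x⁻¹ * ((F.eps ^ (i : ℕ) : F.Units) : F.Elem)) := by
        refine ⟨x⁻¹ * b, 0, ?_⟩
        have h2 := F.null.mul_mem_left (inc x⁻¹) h
        rw [← FormalSum.inc_coe (F.eps ^ (i : ℕ)), mul_add, mul_add, ← FormalSum.inc_mul,
          ← FormalSum.inc_mul, ← FormalSum.inc_mul, inv_mul_cancel₀ h0] at h2
        have h3 : inc (1 : F.Elem) = MonoidAlgebra.of ℕ F.Units (F.eps ^ ((0 : Fin 2) : ℕ)) := by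
          rw [← WithZero.coe_one, FormalSum.inc_coe]; simp
        rw [← h3]
        convert h2 using 1
        abel
      have h4 : x⁻¹ = (x⁻¹ * ((F.eps ^ (i : ℕ) : F.Units) : F.Elem)) *
          ((F.eps : F.Units) : F.Elem) ^ (i : ℕ) := by
        rw [mul_assoc, ← WithZero.coe_pow, ← WithZero.coe_mul, ← mul_pow, F.eps_mul_eps, one_pow,
          WithZero.coe_one, mul_one]
      rw [h4]
      exact mul_mem (Submonoid.subset_closure h1) (pow_mem F.eps_mem_foundationMonoid _)

/-- The unit group of the foundation. -/
def foundationUnits (F : Pasture.{u}) : Subgroup F.Units where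
  carrier := {a | (a : F.Elem) ∈ F.foundationMonoid}
  one_mem' := by
    simp only [Set.mem_ofPred_eq, WithZero.coe_one]
    exact one_mem _
  mul_mem' {a b} ha hb := by
    simp only [Set.mem_ofPred_eq, WithZero.coe_mul] at *
    exact mul_mem ha hb
  inv_mem' {a} ha := by
    simp only [Set.mem_ofPred_eq, WithZero.coe_inv] at *
    exact F.inv_mem_foundationMonoid ha

/-- The foundation of `F`: the subpasture of `F` generated by the fundamental elements of `F`. Its
nullset is the restriction of the nullset of `F`. -/
def foundation (F : Pasture.{u}) : Pasture.{u} where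
  Units := F.foundationUnits
  null := F.null.comap (FormalSum.map F.foundationUnits.subtype)
  one_notMem h := F.one_notMem (by rwa [Ideal.mem_comap, map_one] at h)
  existsUnique_eps := by
    refine ⟨⟨F.eps, F.eps_mem_foundationMonoid⟩, ?_, ?_⟩
    · simp only [Ideal.mem_comap, map_add, map_one, FormalSum.map_of]
      exact F.one_add_eps
    · intro e he
      simp only [Ideal.mem_comap, map_add, map_one, FormalSum.map_of] at he
      exact Subtype.ext (F.eq_eps he)

/-- The inclusion of the foundation of `F` into `F`. -/
def foundationIncl (F : Pasture.{u}) : Hom F.foundation F where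
  onUnits := F.foundationUnits.subtype
  map_null _ hs := hs

end Pasture

/-! ## Pasteurization

A pair `(G, N)` of an abelian group `G` and an ideal `N` of `ℕ[G]` presents the ordered blue field
with underlying monoid `G ∪ {0}` whose partial order is generated by the relations `0 ≤ s` with
`s ∈ N`. Suppose that some `1 + e` is in `N`, and that `1` is not, so that `0` is not a weak inverse
of a unit. Then its pasteurization is a pasture, which arises by identifying all elements that have
a common weak inverse. -/

namespace Pasteurization

variable {G : Type u} [CommGroup G]

/-- The subgroup generated by the quotients `a / a'` for which `a` and `a'` have a common
weak inverse. -/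
def subgroup (N : Ideal (MonoidAlgebra ℕ G)) : Subgroup G :=
  Subgroup.closure {c | ∃ a a' b : G, c = a / a' ∧
    MonoidAlgebra.of ℕ G a + MonoidAlgebra.of ℕ G b ∈ N ∧
    MonoidAlgebra.of ℕ G a' + MonoidAlgebra.of ℕ G b ∈ N}

lemma map_mk_surjective (K : Subgroup G) :
    Function.Surjective (FormalSum.map (QuotientGroup.mk' K)) := by
  intro y
  induction y using MonoidAlgebra.induction_on with
  | of g =>
    obtain ⟨a, rfl⟩ := QuotientGroup.mk'_surjective K g
    exact ⟨MonoidAlgebra.of ℕ G a, FormalSum.map_of _ _⟩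
  | add x y hx hy =>
    obtain ⟨a, rfl⟩ := hx
    obtain ⟨b, rfl⟩ := hy
    exact ⟨a + b, map_add _ _ _⟩
  | smul n x hx =>
    obtain ⟨a, rfl⟩ := hx
    exact ⟨n • a, map_nsmul _ _ _⟩

/-- The pasteurization. -/
def pasture (N : Ideal (MonoidAlgebra ℕ G)) (h1 : (1 : MonoidAlgebra ℕ G) ∉ N)
    (he : ∃ e : G, 1 + MonoidAlgebra.of ℕ G e ∈ N) : Pasture.{u} where
  Units := G ⧸ subgroup N
  null := N.map (FormalSum.map (QuotientGroup.mk' (subgroup N)))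
  one_notMem h := by
    rw [Ideal.mem_map_iff_of_surjective (FormalSum.map (QuotientGroup.mk' (subgroup N)))
      (map_mk_surjective _)] at h
    obtain ⟨z, hz, hz1⟩ := h
    rw [← map_one (MonoidAlgebra.of ℕ _)] at hz1
    obtain ⟨a, rfl⟩ := FormalSum.eq_of_of_map_eq _ hz1
    apply h1
    have := N.mul_mem_left (MonoidAlgebra.of ℕ G a⁻¹) hz
    rwa [← map_mul, inv_mul_cancel, map_one] at this
  existsUnique_eps := by
    obtain ⟨e, he⟩ := he
    have key : ∀ e' : G ⧸ subgroup N, 1 + MonoidAlgebra.of ℕ (G ⧸ subgroup N) e' ∈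
        N.map (FormalSum.map (QuotientGroup.mk' (subgroup N))) →
        ∃ b : G, 1 + MonoidAlgebra.of ℕ G b ∈ N ∧ (b : G ⧸ subgroup N) = e' := by
      intro e' h
      rw [Ideal.mem_map_iff_of_surjective (FormalSum.map (QuotientGroup.mk' (subgroup N)))
      (map_mk_surjective _)] at h
      obtain ⟨z, hz, hz1⟩ := h
      rw [← map_one (MonoidAlgebra.of ℕ _)] at hz1
      obtain ⟨a, b, rfl, ha, hb⟩ := FormalSum.eq_add_of_map_eq _ hz1
      refine ⟨a⁻¹ * b, ?_, ?_⟩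
      · have := N.mul_mem_left (MonoidAlgebra.of ℕ G a⁻¹) hz
        rwa [mul_add, ← map_mul, ← map_mul, inv_mul_cancel, map_one] at this
      · change QuotientGroup.mk' (subgroup N) (a⁻¹ * b) = e'
        rw [map_mul, map_inv, ha, hb, inv_one, one_mul]
    refine ⟨(e : G ⧸ subgroup N), ?_, ?_⟩
    · have := Ideal.mem_map_of_mem (FormalSum.map (QuotientGroup.mk' (subgroup N))) he
      rwa [map_add, map_one, FormalSum.map_of] at this
    · intro e' he'
      obtain ⟨b, hb, rfl⟩ := key e' he'
      rw [← div_eq_one, ← QuotientGroup.mk_div, QuotientGroup.eq_one_iff]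
      refine Subgroup.subset_closure ⟨b, e, 1, rfl, ?_, ?_⟩
      · rwa [map_one, add_comm]
      · rwa [map_one, add_comm]

end Pasteurization

/-! ## Matroids of rank `r` on `E` and 3-term Plücker relations -/

/-- A matroid of rank `r` with ground set `E`. -/
structure MatroidOn (E : Type v) (r : ℕ) where
  /-- The matroid. -/
  toMatroid : Matroid E
  ground_eq : toMatroid.E = Set.univ
  eRank_eq : toMatroid.eRank = r

/-- The indices of the 3-term Plücker relations: an `(r-2)`-subset `I` of `E` and elements
`i 0 < i 1 < i 2 < i 3` of `E` that are not in `I`. -/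
structure PluckerIndex (E : Type v) [LinearOrder E] (r : ℕ) where
  /-- The `(r-2)`-subset. -/
  I : Finset E
  card_add_two : I.card + 2 = r
  /-- The four elements. -/
  i : Fin 4 → E
  strictMono : StrictMono i
  notMem : ∀ k, i k ∉ I

namespace PluckerIndex

variable {E : Type v} [LinearOrder E] {r : ℕ}

/-- The `r`-subset `I ∪ {i k, i l}` for `k ≠ l`. -/
def set (Q : PluckerIndex E r) (k l : Fin 4) (h : k ≠ l := by decide) : Set.powersetCard E r :=
  ⟨Q.I ∪ {Q.i k, Q.i l}, by
    rw [Set.powersetCard.mem_iff, Finset.card_union_of_disjoint,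
      Finset.card_pair (Q.strictMono.injective.ne h), Q.card_add_two]
    simp [Q.notMem]⟩

/-- The formal sum
`Δ(I ∪ {i₁, i₂}) Δ(I ∪ {i₃, i₄}) + ε Δ(I ∪ {i₁, i₃}) Δ(I ∪ {i₂, i₄}) + Δ(I ∪ {i₁, i₄}) Δ(I ∪ {i₂, i₃})`
for a function `Δ` on the `r`-subsets of `E`. -/
def sum {G : Type u} [CommGroup G] (Q : PluckerIndex E r) (ε : G)
    (Δ : Set.powersetCard E r → WithZero G) : MonoidAlgebra ℕ G :=
  inc (Δ (Q.set 0 1) * Δ (Q.set 2 3)) +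
    inc ((ε : WithZero G) * Δ (Q.set 0 2) * Δ (Q.set 1 3)) +
    inc (Δ (Q.set 0 3) * Δ (Q.set 1 2))

lemma map_sum {G : Type u} {H : Type w} [CommGroup G] [CommGroup H] (f : G →* H)
    (Q : PluckerIndex E r) (ε : G) (Δ : Set.powersetCard E r → WithZero G) :
    FormalSum.map f (Q.sum ε Δ) = Q.sum (f ε) (fun J => WithZero.map' f (Δ J)) := by
  simp only [sum, map_add, FormalSum.map_inc, map_mul, WithZero.map'_coe]

end PluckerIndex

namespace MatroidOn

variable {E : Type v} [LinearOrder E] {r : ℕ}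

/-- The set of bases of `M`, considered as finite subsets of `E`. -/
abbrev Bases (M : MatroidOn E r) : Type v := {B : Finset E // M.toMatroid.IsBase (B : Set E)}

lemma card_base (M : MatroidOn E r) (B : M.Bases) : B.1.card = r := by
  have h := B.2.encard_eq_eRank
  rw [M.eRank_eq, Set.encard_coe_eq_coe_finsetCard] at h
  exact_mod_cast h

/-- A basis of `M` as an `r`-subset of `E`. -/
def Bases.toSet {M : MatroidOn E r} (B : M.Bases) : Set.powersetCard E r :=
  ⟨B.1, M.card_base B⟩

/-! ### The weak universal pasture -/

/-- The unit group `{1, ε} × ∏ x_B ^ ℤ` of `𝔽₁^±[x_B^± | B a basis of M]`; here `ε = (-1, 1)`. -/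
abbrev Laurent (M : MatroidOn E r) : Type v := ℤˣ × Multiplicative (M.Bases →₀ ℤ)

/-- The weak inverse `ε` of `1` in `𝔽₁^±[x_B^± | B a basis of M]`. -/
def laurentEps (M : MatroidOn E r) : M.Laurent := (-1, 1)

/-- The variable `x_B`. -/
def laurentVar (M : MatroidOn E r) (B : M.Bases) : M.Laurent :=
  (1, Multiplicative.ofAdd (Finsupp.single B 1))

open Classical in
/-- The function `J ↦ x_J` on the `r`-subsets of `E`, where `x_J = 0` if `J` is not a basis. -/
def laurentCoord (M : MatroidOn E r) (J : Set.powersetCard E r) : WithZero M.Laurent :=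
  if h : M.toMatroid.IsBase (J.1 : Set E) then (M.laurentVar ⟨J.1, h⟩ : M.Laurent) else 0

/-- The nullset of `𝔽₁^±[x_B^± | B a basis of M] // Pl^w(r, E)`: the ideal generated by `1 + ε` and
the 3-term Plücker relations. -/
def laurentNull (M : MatroidOn E r) : Ideal (MonoidAlgebra ℕ M.Laurent) :=
  Ideal.span (insert (1 + MonoidAlgebra.of ℕ M.Laurent M.laurentEps)
    (Set.range fun Q : PluckerIndex E r => Q.sum M.laurentEps M.laurentCoord))

/-- The degree of Laurent monomials, where `deg x_B = 1` and `deg ε = 0`. -/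
def laurentDeg (M : MatroidOn E r) : M.Laurent →* Multiplicative ℤ :=
  (AddMonoidHom.toMultiplicative
    (Finsupp.liftAddHom fun _ : M.Bases => AddMonoidHom.id ℤ)).comp (MonoidHom.snd _ _)

/-- The Laurent monomials of degree `0`. -/
abbrev LaurentZero (M : MatroidOn E r) : Subgroup M.Laurent := M.laurentDeg.ker

/-- The nullset of the degree-`0` part of `𝔽₁^±[x_B^± | B a basis of M] // Pl^w(r, E)`. -/
def laurentZeroNull (M : MatroidOn E r) : Ideal (MonoidAlgebra ℕ M.LaurentZero) :=
  M.laurentNull.comap (FormalSum.map M.LaurentZero.subtype)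

lemma laurentEps_mem (M : MatroidOn E r) : M.laurentEps ∈ M.LaurentZero := by
  simp [laurentEps, laurentDeg, MonoidHom.mem_ker]

lemma laurentVar_div_mem (M : MatroidOn E r) (B C : M.Bases) :
    M.laurentVar B / M.laurentVar C ∈ M.LaurentZero := by
  rw [MonoidHom.mem_ker, map_div, div_eq_one]
  simp [laurentVar, laurentDeg]

lemma laurentCoord_ne_zero (M : MatroidOn E r) (J : Set.powersetCard E r) :
    M.laurentCoord J ≠ 0 ↔ M.toMatroid.IsBase (J.1 : Set E) := by
  unfold laurentCoord
  split_ifs with h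
  · exact ⟨fun _ => h, fun _ => WithZero.coe_ne_zero⟩
  · exact ⟨fun h' => absurd rfl h', fun h' => absurd h' h⟩

lemma isBase_pair_comm (M : MatroidOn E r) {S : Set E} {a b : E}
    (h : M.toMatroid.IsBase (S ∪ {a, b})) : M.toMatroid.IsBase (S ∪ {b, a}) := by
  rwa [Set.pair_comm]

lemma exchange_pair (M : MatroidOn E r) {S : Set E} {a b c d : E} (ha : a ∉ S) (hab : a ≠ b)
    (hac : a ≠ c) (had : a ≠ d) (h1 : M.toMatroid.IsBase (S ∪ {a, b}))
    (h2 : M.toMatroid.IsBase (S ∪ {c, d})) :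
    M.toMatroid.IsBase (S ∪ {b, c}) ∨ M.toMatroid.IsBase (S ∪ {b, d}) := by
  obtain ⟨y, ⟨hy1, hy2⟩, hy⟩ := h1.exchange h2 (e := a) (by simp [ha, hac, had])
  have h3 : insert y ((S ∪ {a, b}) \ {a}) = S ∪ {b, y} := by
    ext x
    simp only [Set.mem_insert_iff, Set.mem_sdiff, Set.mem_union, Set.mem_singleton_iff]
    constructor
    · rintro (h | ⟨h | h | h, h'⟩) <;> tauto
    · rintro (h | h | h)
      · exact Or.inr ⟨Or.inl h, fun e => ha (e ▸ h)⟩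
      · exact Or.inr ⟨Or.inr (Or.inr h), fun e => hab (e.symm.trans h)⟩
      · exact Or.inl h
  rw [h3] at hy
  simp only [Set.mem_union, Set.mem_insert_iff, Set.mem_singleton_iff, not_or] at hy1 hy2
  rcases hy1 with h | rfl | rfl
  · exact absurd h hy2.1
  · exact Or.inl hy
  · exact Or.inr hy

/-- If one of three "opposite pairs" consists of bases, then so does another one. -/
lemma exchange_three (M : MatroidOn E r) {S : Set E} {a b c d : E} (ha : a ∉ S) (hb : b ∉ S)
    (hc : c ∉ S) (hd : d ∉ S) (hab : a ≠ b) (hac : a ≠ c) (had : a ≠ d) (hbc : b ≠ c)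
    (hbd : b ≠ d) (hcd : c ≠ d) (h1 : M.toMatroid.IsBase (S ∪ {a, b}))
    (h2 : M.toMatroid.IsBase (S ∪ {c, d})) :
    (M.toMatroid.IsBase (S ∪ {a, c}) ∧ M.toMatroid.IsBase (S ∪ {b, d})) ∨
      (M.toMatroid.IsBase (S ∪ {a, d}) ∧ M.toMatroid.IsBase (S ∪ {b, c})) := by
  have e1 := M.exchange_pair ha hab hac had h1 h2
  have e2 := M.exchange_pair hb hab.symm hbc hbd (M.isBase_pair_comm h1) h2
  have e3 := M.exchange_pair hc hcd hac.symm hbc.symm h2 h1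
  have e4 := M.exchange_pair hd hcd.symm had.symm hbd.symm (M.isBase_pair_comm h2) h1
  rw [Set.pair_comm d a, Set.pair_comm d b] at e3
  rw [Set.pair_comm c a, Set.pair_comm c b] at e4
  tauto

lemma size_sum_ne_one (M : MatroidOn E r) (Q : PluckerIndex E r) :
    FormalSum.size (Q.sum M.laurentEps M.laurentCoord) ≠ 1 := by
  have n : ∀ k l : Fin 4, k ≠ l → Q.i k ≠ Q.i l := fun k l h => Q.strictMono.injective.ne h
  have m : ∀ k, Q.i k ∉ (Q.I : Set E) := fun k => by simpa using Q.notMem k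
  have b : ∀ (k l : Fin 4) (h : k ≠ l), M.laurentCoord (Q.set k l h) ≠ 0 ↔
      M.toMatroid.IsBase ((Q.I : Set E) ∪ {Q.i k, Q.i l}) := fun k l h => by
    rw [laurentCoord_ne_zero]; simp [PluckerIndex.set]
  have x1 := M.exchange_three (m 0) (m 1) (m 2) (m 3) (n 0 1 (by decide)) (n 0 2 (by decide))
    (n 0 3 (by decide)) (n 1 2 (by decide)) (n 1 3 (by decide)) (n 2 3 (by decide))
  have x2 := M.exchange_three (m 0) (m 2) (m 1) (m 3) (n 0 2 (by decide)) (n 0 1 (by decide))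
    (n 0 3 (by decide)) (n 2 1 (by decide)) (n 2 3 (by decide)) (n 1 3 (by decide))
  have x3 := M.exchange_three (m 0) (m 3) (m 1) (m 2) (n 0 3 (by decide)) (n 0 1 (by decide))
    (n 0 2 (by decide)) (n 3 1 (by decide)) (n 3 2 (by decide)) (n 1 2 (by decide))
  rw [Set.pair_comm (Q.i 2) (Q.i 1)] at x2
  rw [Set.pair_comm (Q.i 3) (Q.i 2), Set.pair_comm (Q.i 3) (Q.i 1)] at x3
  rw [← b 0 1 (by decide), ← b 2 3 (by decide), ← b 0 2 (by decide), ← b 1 3 (by decide),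
    ← b 0 3 (by decide), ← b 1 2 (by decide)] at x1 x2 x3
  have s1 : ∀ a b : WithZero M.Laurent, ((a ≠ 0 ∧ b ≠ 0) ∧ FormalSum.size (inc (a * b)) = 1) ∨
      (¬ (a ≠ 0 ∧ b ≠ 0) ∧ FormalSum.size (inc (a * b)) = 0) := fun a b => by
    by_cases h : a ≠ 0 ∧ b ≠ 0
    · exact Or.inl ⟨h, FormalSum.size_inc_of_ne (mul_ne_zero h.1 h.2)⟩
    · refine Or.inr ⟨h, ?_⟩
      have h0 : a * b = 0 := by
        by_contra h'
        exact h ⟨left_ne_zero_of_mul h', right_ne_zero_of_mul h'⟩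
      rw [h0, FormalSum.inc_zero, map_zero]
  have s2 : ∀ a b : WithZero M.Laurent,
      FormalSum.size (inc ((M.laurentEps : WithZero M.Laurent) * a * b)) =
        FormalSum.size (inc (a * b)) := fun a b => by
    rw [mul_assoc, FormalSum.inc_mul, map_mul, FormalSum.inc_coe, FormalSum.size_of, one_mul]
  unfold PluckerIndex.sum
  rw [map_add, map_add, s2]
  intro hs
  rcases s1 (M.laurentCoord (Q.set 0 1)) (M.laurentCoord (Q.set 2 3)) with ⟨u1, t1⟩ | ⟨u1, t1⟩ <;>
  rcases s1 (M.laurentCoord (Q.set 0 2)) (M.laurentCoord (Q.set 1 3)) with ⟨u2, t2⟩ | ⟨u2, t2⟩ <;>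
  rcases s1 (M.laurentCoord (Q.set 0 3)) (M.laurentCoord (Q.set 1 2)) with ⟨u3, t3⟩ | ⟨u3, t3⟩ <;>
  rw [t1, t2, t3] at hs
  · exact absurd hs (by decide)
  · exact absurd hs (by decide)
  · exact absurd hs (by decide)
  · exact (x1 u1.1 u1.2).elim u2 u3
  · exact absurd hs (by decide)
  · exact (x2 u2.1 u2.2).elim u1 u3
  · exact (x3 u3.1 u3.2).elim u1 u2
  · exact absurd hs (by decide)

lemma one_notMem_laurentZeroNull (M : MatroidOn E r) :
    (1 : MonoidAlgebra ℕ M.LaurentZero) ∉ M.laurentZeroNull := by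
  let P : Ideal ℕ :=
    { carrier := {n | n ≠ 1}
      zero_mem' := zero_ne_one
      add_mem' := fun {a b} ha hb => by simp only [Set.mem_ofPred_eq] at *; omega
      smul_mem' := fun c x hx => by
        simp only [Set.mem_ofPred_eq, smul_eq_mul] at *
        intro h
        exact hx (Nat.eq_one_of_mul_eq_one_left h) }
  have hP : M.laurentNull ≤ P.comap (FormalSum.size (G := M.Laurent)) := by
    refine Ideal.span_le.2 (Set.insert_subset ?_ ?_)
    · change FormalSum.size (1 + MonoidAlgebra.of ℕ M.Laurent M.laurentEps) ≠ 1
      rw [map_add, map_one, FormalSum.size_of]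
      decide
    · rintro _ ⟨Q, rfl⟩
      exact M.size_sum_ne_one Q
  intro h
  rw [laurentZeroNull, Ideal.mem_comap, map_one] at h
  have h2 : FormalSum.size (1 : MonoidAlgebra ℕ M.Laurent) ≠ 1 := hP h
  exact h2 (map_one (FormalSum.size (G := M.Laurent)))

lemma one_add_eps_mem_laurentZeroNull (M : MatroidOn E r) :
    1 + MonoidAlgebra.of ℕ M.LaurentZero ⟨M.laurentEps, M.laurentEps_mem⟩ ∈ M.laurentZeroNull := by
  rw [laurentZeroNull, Ideal.mem_comap, map_add, map_one, FormalSum.map_of]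
  exact Ideal.subset_span (Set.mem_insert _ _)

/-- The weak universal pasture
`k_M^w = ((𝔽₁^±[x_B^± | B a basis of M] // Pl^w(r, E))₀)^±` of `M`. -/
def weakUniversalPasture (M : MatroidOn E r) : Pasture.{v} :=
  Pasteurization.pasture M.laurentZeroNull M.one_notMem_laurentZeroNull
    ⟨_, M.one_add_eps_mem_laurentZeroNull⟩

/-- The foundation `k_M^f` of `M`. -/
def foundation (M : MatroidOn E r) : Pasture.{v} := M.weakUniversalPasture.foundation

end MatroidOn

/-! ## Weak Grassmann-Plücker functions -/

section WeakGP

variable {E : Type v} [LinearOrder E] {r : ℕ}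

/-- A weak Grassmann-Plücker function of rank `r` on `E` with coefficients in `F` that represents
`M`: a function from the `r`-subsets of `E` to `F` whose support is the set of bases of `M` and
which satisfies the 3-term Plücker relations. -/
@[ext] structure WeakGP (M : MatroidOn E r) (F : Pasture.{u}) where
  /-- The function. -/
  toFun : Set.powersetCard E r → F.Elem
  support : ∀ J, toFun J ≠ 0 ↔ M.toMatroid.IsBase (J.1 : Set E)
  plucker : ∀ Q : PluckerIndex E r, Q.sum F.eps toFun ∈ F.null

namespace WeakGP

variable {M : MatroidOn E r} {F : Pasture.{u}} {F' : Pasture.{w}}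

/-- The value of `Δ` at a basis, as an element of `Fˣ`. -/
def unit (Δ : WeakGP M F) (B : M.Bases) : F.Units :=
  WithZero.unzero ((Δ.support B.toSet).2 B.2)

lemma coe_unit (Δ : WeakGP M F) (B : M.Bases) : (Δ.unit B : F.Elem) = Δ.toFun B.toSet :=
  WithZero.coe_unzero _

lemma unit_eq (Δ : WeakGP M F) (B : M.Bases) {a : F.Units} (h : Δ.toFun B.toSet = (a : F.Elem)) :
    Δ.unit B = a := by
  rw [← WithZero.coe_inj, coe_unit, h]

/-- Rescaling of a weak Grassmann-Plücker function: `(a • t.Δ)(J) = a * (∏ j ∈ J, t j) * Δ(J)`. -/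
def rescale (a : F.Units) (t : E → F.Units) (Δ : WeakGP M F) : WeakGP M F where
  toFun J := ((a * ∏ j ∈ J.1, t j : F.Units) : F.Elem) * Δ.toFun J
  support J := by rw [← Δ.support J]; simp
  plucker Q := by
    have hp : ∀ (k l : Fin 4) (h : k ≠ l),
        (∏ j ∈ (Q.set k l h).1, t j) = (∏ j ∈ Q.I, t j) * (t (Q.i k) * t (Q.i l)) := by
      intro k l h
      simp only [PluckerIndex.set]
      rw [Finset.prod_union (by simp [Q.notMem]), Finset.prod_pair (Q.strictMono.injective.ne h)]
    have h := F.null.mul_mem_left (inc ((a * a * (∏ j ∈ Q.I, t j) * (∏ j ∈ Q.I, t j) *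
      (t (Q.i 0) * t (Q.i 1) * t (Q.i 2) * t (Q.i 3)) : F.Units) : F.Elem)) (Δ.plucker Q)
    convert h using 1
    unfold PluckerIndex.sum
    simp only [hp, mul_add, ← FormalSum.inc_mul, WithZero.coe_mul]
    congr 1
    · congr 1
      · congr 1; ac_rfl
      · congr 1; ac_rfl
    · congr 1; ac_rfl

/-- Multiplication of a weak Grassmann-Plücker function by a scalar `a ∈ Fˣ`. -/
def scale (a : F.Units) (Δ : WeakGP M F) : WeakGP M F := rescale a 1 Δ

/-- The torus action `(t.Δ)(J) = (∏ j ∈ J, t j) * Δ(J)` of `t : E → Fˣ`. -/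
def torus (t : E → F.Units) (Δ : WeakGP M F) : WeakGP M F := rescale 1 t Δ

lemma scale_toFun (a : F.Units) (Δ : WeakGP M F) (J : Set.powersetCard E r) :
    (Δ.scale a).toFun J = (a : F.Elem) * Δ.toFun J := by
  simp [scale, rescale]

lemma torus_toFun (t : E → F.Units) (Δ : WeakGP M F) (J : Set.powersetCard E r) :
    (Δ.torus t).toFun J = ((∏ j ∈ J.1, t j : F.Units) : F.Elem) * Δ.toFun J := by
  simp [torus, rescale]

/-- Two weak Grassmann-Plücker functions are equivalent if `Δ = a Δ'` for some `a ∈ Fˣ`. -/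
instance setoid (M : MatroidOn E r) (F : Pasture.{u}) : Setoid (WeakGP M F) where
  r Δ Δ' := ∃ a : F.Units, Δ = Δ'.scale a
  iseqv :=
    { refl := fun Δ => ⟨1, by ext1; funext J; simp [scale_toFun]⟩
      symm := by
        rintro _ Δ ⟨a, rfl⟩
        refine ⟨a⁻¹, ?_⟩
        ext1; funext J
        rw [scale_toFun, scale_toFun, ← mul_assoc, ← WithZero.coe_mul, inv_mul_cancel,
          WithZero.coe_one, one_mul]
      trans := by
        rintro _ _ Δ ⟨a, rfl⟩ ⟨b, rfl⟩
        refine ⟨a * b, ?_⟩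
        ext1; funext J
        rw [scale_toFun, scale_toFun, scale_toFun, WithZero.coe_mul, mul_assoc] }

/-- The composition of a weak Grassmann-Plücker function with a morphism of pastures. -/
def push (f : Pasture.Hom F F') (Δ : WeakGP M F) : WeakGP M F' where
  toFun J := f.app (Δ.toFun J)
  support J := by rw [← Δ.support J, ne_eq, ne_eq, map_eq_zero]
  plucker Q := by
    have h := f.map_null _ (Δ.plucker Q)
    rwa [PluckerIndex.map_sum, f.map_eps] at h

end WeakGP

/-- The weak `F`-matroids with underlying matroid `M`: the classes `[Δ]` of weak Grassmann-Plücker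
functions that represent `M`. -/
def WeakMatroid (M : MatroidOn E r) (F : Pasture.{u}) : Type (max u v) :=
  Quotient (WeakGP.setoid M F)

namespace WeakMatroid

variable {M : MatroidOn E r} {F : Pasture.{u}} {F' : Pasture.{w}} {F'' : Pasture.{z}}

/-- The weak matroid `[Δ]`. -/
def mk (Δ : WeakGP M F) : WeakMatroid M F := Quotient.mk (WeakGP.setoid M F) Δ

/-- The action `t.[Δ] = [t.Δ]` of the torus `T(F) = (E → Fˣ)` on weak `F`-matroids. -/
instance torusAction (M : MatroidOn E r) (F : Pasture.{u}) :
    MulAction (E → F.Units) (WeakMatroid M F) where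
  smul t := Quotient.map (WeakGP.torus t) (by
    rintro _ Δ ⟨a, rfl⟩
    refine ⟨a, ?_⟩
    ext1; funext J
    simp only [WeakGP.torus_toFun, WeakGP.scale_toFun]
    exact mul_left_comm _ _ _)
  one_smul := by
    rintro ⟨Δ⟩
    refine congrArg (Quotient.mk (WeakGP.setoid M F)) ?_
    ext1; funext J
    simp [WeakGP.torus_toFun]
  mul_smul t t' := by
    rintro ⟨Δ⟩
    refine congrArg (Quotient.mk (WeakGP.setoid M F)) ?_
    ext1; funext J
    simp only [WeakGP.torus_toFun, Pi.mul_apply, Finset.prod_mul_distrib, WithZero.coe_mul,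
      mul_assoc]

lemma smul_mk (t : E → F.Units) (Δ : WeakGP M F) : t • mk Δ = mk (Δ.torus t) := rfl

/-- The pushforward `[Δ] ↦ [f ∘ Δ]` along a morphism of pastures. -/
def push (f : Pasture.Hom F F') : WeakMatroid M F → WeakMatroid M F' :=
  Quotient.map (WeakGP.push f) (by
    rintro _ Δ ⟨a, rfl⟩
    refine ⟨f.onUnits a, ?_⟩
    ext1; funext J
    simp only [WeakGP.push, WeakGP.scale_toFun, map_mul]
    rfl)

lemma push_mk (f : Pasture.Hom F F') (Δ : WeakGP M F) : push f (mk Δ) = mk (Δ.push f) := rfl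

lemma push_smul (f : Pasture.Hom F F') (t : E → F.Units) (x : WeakMatroid M F) :
    push f (t • x) = (fun i => f.onUnits (t i)) • push f x := by
  obtain ⟨Δ⟩ := x
  refine congrArg (Quotient.mk (WeakGP.setoid M F')) ?_
  ext1; funext J
  simp only [WeakGP.push, WeakGP.torus_toFun, map_mul]
  rw [← map_prod]
  rfl

lemma push_id (x : WeakMatroid M F) : push (Pasture.Hom.id F) x = x := by
  obtain ⟨Δ⟩ := x
  refine congrArg (Quotient.mk (WeakGP.setoid M F)) ?_
  ext1; funext J
  simp only [WeakGP.push, Pasture.Hom.id, Pasture.Hom.app]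
  exact DFunLike.congr_fun WithZero.map'_id _

lemma push_comp (g : Pasture.Hom F' F'') (f : Pasture.Hom F F') (x : WeakMatroid M F) :
    push (g.comp f) x = push g (push f x) := by
  obtain ⟨Δ⟩ := x
  refine congrArg (Quotient.mk (WeakGP.setoid M F'')) ?_
  ext1; funext J
  exact DFunLike.congr_fun (WithZero.map'_comp f.onUnits g.onUnits) _

end WeakMatroid

/-! ## Rescaling classes -/

/-- Two weak Grassmann-Plücker functions `Δ` and `Δ'` are rescaling equivalent if `[Δ]` and `[Δ']`
lie in the same orbit of the torus action. -/
def WeakGP.RescalingEquivalent {M : MatroidOn E r} {F : Pasture.{u}} (Δ Δ' : WeakGP M F) : Prop :=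
  WeakMatroid.mk Δ ∈ MulAction.orbit (E → F.Units) (WeakMatroid.mk Δ')

/-- The set of rescaling classes of weak `F`-matroids with underlying matroid `M`, i.e. the set
of orbits of the torus action. -/
def RescalingClass (M : MatroidOn E r) (F : Pasture.{u}) : Type (max u v) :=
  MulAction.orbitRel.Quotient (E → F.Units) (WeakMatroid M F)

namespace RescalingClass

variable {M : MatroidOn E r} {F : Pasture.{u}} {F' : Pasture.{w}} {F'' : Pasture.{z}}

/-- The rescaling class of a weak matroid. -/
def mk (x : WeakMatroid M F) : RescalingClass M F :=
  Quotient.mk (MulAction.orbitRel (E → F.Units) (WeakMatroid M F)) x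

/-- The map between sets of rescaling classes that is induced by a morphism of pastures. -/
def push (f : Pasture.Hom F F') : RescalingClass M F → RescalingClass M F' :=
  Quotient.map (WeakMatroid.push f) (by
    rintro _ x ⟨t, rfl⟩
    exact ⟨fun i => f.onUnits (t i), (WeakMatroid.push_smul f t x).symm⟩)

lemma push_mk (f : Pasture.Hom F F') (x : WeakMatroid M F) :
    push f (mk x) = mk (WeakMatroid.push f x) := rfl

lemma push_id (c : RescalingClass M F) : push (Pasture.Hom.id F) c = c := by
  obtain ⟨x⟩ := c
  exact congrArg mk (WeakMatroid.push_id x)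

lemma push_comp (g : Pasture.Hom F' F'') (f : Pasture.Hom F F') (c : RescalingClass M F) :
    push (g.comp f) c = push g (push f c) := by
  obtain ⟨x⟩ := c
  exact congrArg mk (WeakMatroid.push_comp g f x)

end RescalingClass

/-! ## Cross ratios -/

/-- The set `Ω_M` of tuples `(I, i₁, i₂, i₃, i₄)` of an `(r-2)`-subset `I` of `E` and elements
`i₁, …, i₄` of `E` such that `I ∪ {i₁, i₂}`, `I ∪ {i₂, i₃}`, `I ∪ {i₃, i₄}` and `I ∪ {i₄, i₁}` are
bases of `M`. -/
structure CrossRatioIndex (M : MatroidOn E r) where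
  /-- The `(r-2)`-subset. -/
  I : Finset E
  card_add_two : I.card + 2 = r
  /-- The first element. -/
  i₁ : E
  /-- The second element. -/
  i₂ : E
  /-- The third element. -/
  i₃ : E
  /-- The fourth element. -/
  i₄ : E
  isBase₁₂ : M.toMatroid.IsBase ((I ∪ {i₁, i₂} : Finset E) : Set E)
  isBase₂₃ : M.toMatroid.IsBase ((I ∪ {i₂, i₃} : Finset E) : Set E)
  isBase₃₄ : M.toMatroid.IsBase ((I ∪ {i₃, i₄} : Finset E) : Set E)
  isBase₄₁ : M.toMatroid.IsBase ((I ∪ {i₄, i₁} : Finset E) : Set E)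

/-- The cross ratio function of a weak Grassmann-Plücker function. -/
def WeakGP.crossRatio {M : MatroidOn E r} {F : Pasture.{u}} (Δ : WeakGP M F)
    (q : CrossRatioIndex M) : F.Units :=
  (Δ.unit ⟨_, q.isBase₁₂⟩ * Δ.unit ⟨_, q.isBase₃₄⟩) /
    (Δ.unit ⟨_, q.isBase₂₃⟩ * Δ.unit ⟨_, q.isBase₄₁⟩)

/-! ## The characteristic morphism -/

/-- The group homomorphism `{1, ε} → Fˣ`. -/
def Pasture.signHom (F : Pasture.{u}) : ℤˣ →* F.Units where
  toFun s := if s = 1 then 1 else F.eps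
  map_one' := by simp
  map_mul' s t := by
    rcases Int.units_eq_one_or s with rfl | rfl <;> rcases Int.units_eq_one_or t with rfl | rfl <;>
      simp [F.eps_mul_eps]

namespace WeakGP

variable {M : MatroidOn E r} {F : Pasture.{u}}

/-- The evaluation of Laurent monomials: it sends `∏ x_B ^ e_B` to `∏ Δ(B) ^ e_B` and `ε` to
`ε`. -/
def evalHom (Δ : WeakGP M F) : M.Laurent →* F.Units :=
  F.signHom.coprod (AddMonoidHom.toMultiplicativeLeft (Finsupp.liftAddHom fun B : M.Bases =>
    zmultiplesHom (Additive F.Units) (Additive.ofMul (Δ.unit B))))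

lemma evalHom_eps (Δ : WeakGP M F) : Δ.evalHom M.laurentEps = F.eps := by
  simp [evalHom, MatroidOn.laurentEps, Pasture.signHom]

lemma evalHom_var (Δ : WeakGP M F) (B : M.Bases) : Δ.evalHom (M.laurentVar B) = Δ.unit B := by
  simp [evalHom, MatroidOn.laurentVar]

lemma evalHom_coord (Δ : WeakGP M F) (J : Set.powersetCard E r) :
    WithZero.map' Δ.evalHom (M.laurentCoord J) = Δ.toFun J := by
  unfold MatroidOn.laurentCoord
  split_ifs with h
  · rw [WithZero.map'_coe, evalHom_var, coe_unit]
    rfl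
  · have := (Δ.support J).not.2 h
    rw [map_zero, not_not.1 this]

lemma evalHom_null (Δ : WeakGP M F) (s : MonoidAlgebra ℕ M.Laurent) (hs : s ∈ M.laurentNull) :
    FormalSum.map Δ.evalHom s ∈ F.null := by
  have h : M.laurentNull ≤ F.null.comap (FormalSum.map Δ.evalHom) := by
    refine Ideal.span_le.2 (Set.insert_subset ?_ ?_)
    · simp only [SetLike.mem_coe, Ideal.mem_comap, map_add, map_one, FormalSum.map_of, evalHom_eps]
      exact F.one_add_eps
    · rintro _ ⟨Q, rfl⟩
      simp only [SetLike.mem_coe, Ideal.mem_comap, PluckerIndex.map_sum, evalHom_eps,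
        evalHom_coord]
      exact Δ.plucker Q
  exact h hs

/-- The evaluation of Laurent monomials of degree `0`. -/
def evalZeroHom (Δ : WeakGP M F) : M.LaurentZero →* F.Units :=
  Δ.evalHom.comp M.LaurentZero.subtype

lemma evalZeroHom_null (Δ : WeakGP M F) (s : MonoidAlgebra ℕ M.LaurentZero)
    (hs : s ∈ M.laurentZeroNull) : FormalSum.map Δ.evalZeroHom s ∈ F.null := by
  have h := Δ.evalHom_null _ (Ideal.mem_comap.1 hs)
  rwa [evalZeroHom, FormalSum.map, MonoidAlgebra.mapDomainRingHom_comp]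

lemma subgroup_le_ker (Δ : WeakGP M F) :
    Pasteurization.subgroup M.laurentZeroNull ≤ Δ.evalZeroHom.ker := by
  refine (Subgroup.closure_le _).2 ?_
  rintro _ ⟨a, a', b, rfl, h, h'⟩
  have e := Δ.evalZeroHom_null _ h
  have e' := Δ.evalZeroHom_null _ h'
  rw [map_add, FormalSum.map_of, FormalSum.map_of, add_comm] at e e'
  rw [SetLike.mem_coe, MonoidHom.mem_ker, map_div, F.eq_eps_mul e, F.eq_eps_mul e', div_self']

/-- The morphism `k_M^w → F` that sends the class of `∏ x_B ^ e_B` (with `∑ e_B = 0`) to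
`∏ Δ(B) ^ e_B`. -/
def charMorphism (Δ : WeakGP M F) : Pasture.Hom M.weakUniversalPasture F where
  onUnits := QuotientGroup.lift (Pasteurization.subgroup M.laurentZeroNull) Δ.evalZeroHom
    Δ.subgroup_le_ker
  map_null s hs := by
    obtain ⟨y, hy, rfl⟩ := (Ideal.mem_map_iff_of_surjective
      (FormalSum.map (QuotientGroup.mk' (Pasteurization.subgroup M.laurentZeroNull)))
      (Pasteurization.map_mk_surjective _)).1 hs
    have h := Δ.evalZeroHom_null y hy
    rw [← QuotientGroup.lift_comp_mk' (Pasteurization.subgroup M.laurentZeroNull) Δ.evalZeroHom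
      Δ.subgroup_le_ker, FormalSum.map, MonoidAlgebra.mapDomainRingHom_comp] at h
    exact h

lemma evalHom_scale (a : F.Units) (Δ : WeakGP M F) :
    (Δ.scale a).evalHom =
      Δ.evalHom * (zpowersHom F.Units a).comp M.laurentDeg := by
  have hu : ∀ B, (Δ.scale a).unit B = a * Δ.unit B := fun B =>
    unit_eq _ _ (by rw [scale_toFun, WithZero.coe_mul, coe_unit])
  have h : ∀ e : M.Bases →₀ ℤ, (Δ.scale a).evalHom (1, Multiplicative.ofAdd e) =
      Δ.evalHom (1, Multiplicative.ofAdd e) *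
        a ^ (M.laurentDeg (1, Multiplicative.ofAdd e)).toAdd := by
    intro e
    induction e using Finsupp.induction_linear with
    | zero => simp [evalHom, MatroidOn.laurentDeg]
    | add f g hf hg =>
      have hs : ((1, Multiplicative.ofAdd (f + g)) : M.Laurent) =
        (1, Multiplicative.ofAdd f) * (1, Multiplicative.ofAdd g) := rfl
      rw [hs, map_mul, map_mul, map_mul, hf, hg, toAdd_mul, zpow_add]
      exact mul_mul_mul_comm _ _ _ _
    | single B n =>
      simp [evalHom, MatroidOn.laurentDeg, hu, mul_comm]
  ext1 ⟨s, e⟩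
  have hs : ((s, e) : M.Laurent) = (s, 1) * (1, e) := by simp
  have h1 : (Δ.scale a).evalHom (s, 1) = Δ.evalHom (s, 1) := by simp [evalHom]
  have h2 : M.laurentDeg (s, 1) = 1 := by simp [MatroidOn.laurentDeg]
  rw [hs, map_mul, map_mul, h1, MonoidHom.mul_apply, MonoidHom.mul_apply, MonoidHom.comp_apply,
    MonoidHom.comp_apply, h2, map_one, mul_one, zpowersHom_apply]
  exact congrArg _ (h e.toAdd)

lemma charMorphism_scale (a : F.Units) (Δ : WeakGP M F) :
    (Δ.scale a).charMorphism = Δ.charMorphism := by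
  ext x
  obtain ⟨y, rfl⟩ := QuotientGroup.mk'_surjective _ x
  change (Δ.scale a).evalHom y.1 = Δ.evalHom y.1
  rw [evalHom_scale, MonoidHom.mul_apply, MonoidHom.comp_apply, MonoidHom.mem_ker.1 y.2, map_one,
    mul_one]

end WeakGP

/-- The characteristic morphism `χ_[Δ] : k_M^w → F` of a weak `F`-matroid `[Δ]`. -/
def WeakMatroid.charMorphism {M : MatroidOn E r} {F : Pasture.{u}} (x : WeakMatroid M F) :
    Pasture.Hom M.weakUniversalPasture F :=
  Quotient.lift WeakGP.charMorphism (by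
    rintro _ Δ ⟨a, rfl⟩
    exact WeakGP.charMorphism_scale a Δ) x

/-- The restriction `χ_[Δ]|_{k_M^f}` of the characteristic morphism to the foundation of `M`. -/
def WeakMatroid.charMorphismFoundation {M : MatroidOn E r} {F : Pasture.{u}}
    (x : WeakMatroid M F) : Pasture.Hom M.foundation F :=
  x.charMorphism.comp M.weakUniversalPasture.foundationIncl

end WeakGP

end

/-! Everything rests on one combinatorial fact, `CrossRatioTrivial.exists_eq_add_sum`: a function
`φ` on the bases, with values in an abelian group, whose cross ratios are all trivial has the form
`B ↦ a + ∑ j ∈ B, t j`. Fix a basis `B` and regard `φ (B - b + e) - φ B` as the gain of the edge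
from `b` to `e` in the bipartite fundamental graph of `B`. Closed walks have gain zero
(`CrossRatioTrivial.shortcutsTrivial`): four-cycles do by a single cross ratio, and suitable chords
split a longer closed walk into shorter ones. If these chords are missing, a pivot at one edge
replaces three consecutive edges by one and yields a walk shorter by two in the fundamental graph of
another basis; hence the induction treats all bases at once. So the gains have a potential `t`.
After subtracting its sums and a constant, `φ` vanishes at `B` and at its neighbours. A double
exchange is determined by single ones through a cross ratio, so the vanishing spreads to all bases.

Applied to the quotient of two functions with equal cross ratios, this gives rescaling equivalence.
The link with morphisms is that the units of the foundation are generated by `ε` and the universal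
cross ratios. Cross ratios lie in the foundation because the quotient of two nonzero terms of a
three-term relation is fundamental. Conversely, let `K` be a group of units containing `ε` and the
cross ratios. The null sums that have at least four summands or lie in one coset of `K` form an
ideal (`Pasture.cosetIdeal`), which contains the generators of the nullset. The relation witnessing
a fundamental element has at most three summands, so that element lies in `K` if it is a unit.

For surjectivity, the universal function has trivial cross ratios modulo the units of the
foundation. By the combinatorial fact it can be rescaled to take values in the foundation, and the
resulting characteristic morphism restricts to the identity. Pushing forward along `f` then realizes
`f`. -/

noncomputable section

open FormalSum (inc)

/-! ### Exchanges at a basis and its fundamental graph -/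

namespace MatroidOn

variable {E : Type v} [LinearOrder E] {r : ℕ} {A : Type w} [AddCommGroup A]

/-- The set `B - b + e`. -/
def swap (B : Finset E) (b e : E) : Finset E := insert e (B.erase b)

/-- The edges of the fundamental graph of a basis `B`, directed from `B` to its complement. -/
def IsSwap (M : MatroidOn E r) (B : Finset E) (b e : E) : Prop :=
  b ∈ B ∧ e ∉ B ∧ M.toMatroid.IsBase (swap B b e : Set E)

/-- Adjacency in the fundamental graph of `B`. -/
def FundAdj (M : MatroidOn E r) (B : Finset E) (x y : E) : Prop :=
  M.IsSwap B x y ∨ M.IsSwap B y x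

/-- The change of `φ` along an edge of the fundamental graph of `B`. -/
def gain (φ : Finset E → A) (B : Finset E) (x y : E) : A :=
  if x ∈ B then φ (swap B x y) - φ B else φ B - φ (swap B y x)

/-- All cross ratios of `φ` are trivial. -/
def CrossRatioTrivial (M : MatroidOn E r) (φ : Finset E → A) : Prop :=
  ∀ (I : Finset E) (a b c d : E), I.card + 2 = r →
    M.toMatroid.IsBase ((I ∪ {a, b} : Finset E) : Set E) →
    M.toMatroid.IsBase ((I ∪ {b, c} : Finset E) : Set E) →
    M.toMatroid.IsBase ((I ∪ {c, d} : Finset E) : Set E) →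
    M.toMatroid.IsBase ((I ∪ {d, a} : Finset E) : Set E) →
    φ (I ∪ {a, b}) + φ (I ∪ {c, d}) = φ (I ∪ {b, c}) + φ (I ∪ {d, a})

variable {M : MatroidOn E r} {φ : Finset E → A} {B : Finset E}

lemma FundAdj.symm {x y : E} (h : M.FundAdj B x y) : M.FundAdj B y x := Or.symm h

lemma FundAdj.mem_iff {x y : E} (h : M.FundAdj B x y) : x ∈ B ↔ y ∉ B := by
  rcases h with ⟨h1, h2, -⟩ | ⟨h1, h2, -⟩ <;> tauto

lemma FundAdj.isSwap {x y : E} (h : M.FundAdj B x y) (hx : x ∈ B) : M.IsSwap B x y := by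
  rcases h with h | ⟨-, h2, -⟩
  · exact h
  · exact absurd hx h2

lemma IsSwap.gain_eq {b e : E} (h : M.IsSwap B b e) : gain φ B b e = φ (swap B b e) - φ B :=
  if_pos h.1

lemma FundAdj.gain_comm {x y : E} (h : M.FundAdj B x y) : gain φ B y x = - gain φ B x y := by
  have := h.mem_iff
  unfold gain
  by_cases hx : x ∈ B <;> by_cases hy : y ∈ B <;> simp_all

section FourPoints

variable {b₁ b₂ e₁ e₂ : E}

lemma sdiff_pair_union (h1 : b₁ ∈ B) (h2 : b₂ ∈ B) : B \ {b₁, b₂} ∪ {b₁, b₂} = B := by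
  ext x; simp only [Finset.mem_union, Finset.mem_sdiff, Finset.mem_insert, Finset.mem_singleton]
  grind

lemma sdiff_pair_union_left (h1 : b₁ ∈ B) (hb : b₁ ≠ b₂) :
    B \ {b₁, b₂} ∪ {b₁, e₁} = swap B b₂ e₁ := by
  ext x; simp only [swap, Finset.mem_union, Finset.mem_sdiff, Finset.mem_insert,
    Finset.mem_singleton, Finset.mem_erase]
  grind

lemma sdiff_pair_union_right (h2 : b₂ ∈ B) (hb : b₁ ≠ b₂) :
    B \ {b₁, b₂} ∪ {b₂, e₁} = swap B b₁ e₁ := by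
  rw [Finset.pair_comm b₁ b₂]
  exact sdiff_pair_union_left h2 hb.symm

lemma sdiff_pair_union_new (h2 : b₂ ∈ B) (h3 : e₁ ∉ B) :
    B \ {b₁, b₂} ∪ {e₁, e₂} = swap (swap B b₁ e₁) b₂ e₂ := by
  ext x; simp only [swap, Finset.mem_union, Finset.mem_sdiff, Finset.mem_insert,
    Finset.mem_singleton, Finset.mem_erase]
  grind

lemma card_sdiff_pair (hB : M.toMatroid.IsBase (B : Set E)) (h1 : b₁ ∈ B) (h2 : b₂ ∈ B)
    (hb : b₁ ≠ b₂) : (B \ {b₁, b₂}).card + 2 = r := by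
  have h := M.card_base ⟨B, hB⟩
  have hs : ({b₁, b₂} : Finset E) ⊆ B := by
    intro x; simp only [Finset.mem_insert, Finset.mem_singleton]; grind
  have := Finset.card_sdiff_add_card_eq_card hs
  rw [Finset.card_pair hb] at this
  exact this.trans h

lemma swap_swap_comm (h2 : b₂ ∈ B) (h3 : e₁ ∉ B) (h4 : e₂ ∉ B) :
    swap (swap B b₁ e₁) b₂ e₂ = swap (swap B b₁ e₂) b₂ e₁ := by
  rw [← sdiff_pair_union_new h2 h3, ← sdiff_pair_union_new h2 h4, Finset.pair_comm e₁]

/-- In a four-cycle of the fundamental graph, the gains cancel. -/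
lemma CrossRatioTrivial.four_cycle (hφ : M.CrossRatioTrivial φ)
    (hB : M.toMatroid.IsBase (B : Set E)) (hb : b₁ ≠ b₂) (h11 : M.IsSwap B b₁ e₁)
    (h12 : M.IsSwap B b₁ e₂) (h21 : M.IsSwap B b₂ e₁) (h22 : M.IsSwap B b₂ e₂) :
    φ (swap B b₁ e₁) + φ (swap B b₂ e₂) = φ (swap B b₁ e₂) + φ (swap B b₂ e₁) := by
  have h := hφ (B \ {b₁, b₂}) b₂ e₁ b₁ e₂ (card_sdiff_pair hB h11.1 h21.1 hb)
  rw [Finset.pair_comm e₁ b₁, Finset.pair_comm e₂ b₂] at h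
  rw [sdiff_pair_union_left h11.1 hb, sdiff_pair_union_left h11.1 hb,
    sdiff_pair_union_right h21.1 hb, sdiff_pair_union_right h21.1 hb] at h
  rw [h h11.2.2 h21.2.2 h22.2.2 h12.2.2, add_comm]

/-- If a double exchange splits into two single exchanges, then its gain is the sum of theirs. -/
lemma CrossRatioTrivial.double_swap (hφ : M.CrossRatioTrivial φ)
    (hB : M.toMatroid.IsBase (B : Set E)) (hb : b₁ ≠ b₂) (h11 : M.IsSwap B b₁ e₁)
    (h22 : M.IsSwap B b₂ e₂)
    (h : M.toMatroid.IsBase (swap (swap B b₁ e₁) b₂ e₂ : Set E)) :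
    φ (swap (swap B b₁ e₁) b₂ e₂) = φ (swap B b₁ e₁) + φ (swap B b₂ e₂) - φ B := by
  have h' := hφ (B \ {b₁, b₂}) b₁ b₂ e₁ e₂ (card_sdiff_pair hB h11.1 h22.1 hb)
  rw [Finset.pair_comm e₂ b₁] at h'
  rw [sdiff_pair_union h11.1 h22.1, sdiff_pair_union_left h11.1 hb,
    sdiff_pair_union_right h22.1 hb, sdiff_pair_union_new h22.1 h11.2.1] at h'
  rw [eq_sub_iff_add_eq', h' hB h11.2.2 h h22.2.2]

/-- Over `B \ {b₁, b₂}` there are three opposite pairs: `B` with the double exchange, the two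
parallel exchanges, and the two crossed ones. By `exchange_three` a pair of bases forces a second
such pair, and `h` rules out the crossed one. -/
lemma isBase_double_swap (hb : b₁ ≠ b₂) (he : e₁ ≠ e₂) (h11 : M.IsSwap B b₁ e₁)
    (h22 : M.IsSwap B b₂ e₂)
    (h : ¬ (M.IsSwap B b₁ e₂ ∧ M.IsSwap B b₂ e₁)) :
    M.toMatroid.IsBase (swap (swap B b₁ e₁) b₂ e₂ : Set E) := by
  have m1 := h11.1; have m2 := h22.1; have n1 := h11.2.1; have n2 := h22.2.1
  have h' := M.exchange_three (S := ((B \ {b₁, b₂} : Finset E) : Set E)) (a := b₂) (b := e₁)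
    (c := b₁) (d := e₂) (by simp) (by simp [n1]) (by simp) (by simp [n2])
    (by grind) hb.symm (by grind) (by grind) he (by grind)
  simp only [← Finset.coe_pair, ← Finset.coe_union] at h'
  rw [Finset.pair_comm b₂ b₁, Finset.pair_comm e₁ b₁, sdiff_pair_union m1 m2,
    sdiff_pair_union_left m1 hb, sdiff_pair_union_left m1 hb, sdiff_pair_union_right m2 hb,
    sdiff_pair_union_right m2 hb, sdiff_pair_union_new m2 n1] at h'
  rcases h' h11.2.2 h22.2.2 with h' | h'
  · exact h'.2
  · exact absurd ⟨⟨m1, n2, h'.1⟩, ⟨m2, n1, h'.2⟩⟩ h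

/-- The same three opposite pairs, now starting from `B` and the double exchange. -/
lemma isSwap_of_double_swap (hb : b₁ ≠ b₂) (he : e₁ ≠ e₂) (m1 : b₁ ∈ B) (m2 : b₂ ∈ B)
    (n1 : e₁ ∉ B) (n2 : e₂ ∉ B) (hB : M.toMatroid.IsBase (B : Set E))
    (h : M.toMatroid.IsBase (swap (swap B b₁ e₁) b₂ e₂ : Set E)) :
    (M.IsSwap B b₁ e₁ ∧ M.IsSwap B b₂ e₂) ∨ (M.IsSwap B b₁ e₂ ∧ M.IsSwap B b₂ e₁) := by
  have h' := M.exchange_three (S := ((B \ {b₁, b₂} : Finset E) : Set E)) (a := b₁) (b := b₂)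
    (c := e₁) (d := e₂) (by simp) (by simp) (by simp [n1]) (by simp [n2])
    hb (by grind) (by grind) (by grind) (by grind) he
  simp only [← Finset.coe_pair, ← Finset.coe_union] at h'
  rw [sdiff_pair_union m1 m2,
    sdiff_pair_union_left m1 hb, sdiff_pair_union_left m1 hb, sdiff_pair_union_right m2 hb,
    sdiff_pair_union_right m2 hb, sdiff_pair_union_new m2 n1] at h'
  rcases h' hB h with h' | h'
  · exact Or.inr ⟨⟨m1, n2, h'.2⟩, ⟨m2, n1, h'.1⟩⟩
  · exact Or.inl ⟨⟨m1, n1, h'.2⟩, ⟨m2, n2, h'.1⟩⟩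

end FourPoints

end MatroidOn

/-! ### Pivots, and triviality of gains around closed walks -/

namespace MatroidOn

variable {E : Type v} [LinearOrder E] {r : ℕ} {A : Type w} [AddCommGroup A]
variable {M : MatroidOn E r} {φ : Finset E → A} {B : Finset E}

lemma FundAdj.ne {x y : E} (h : M.FundAdj B x y) : x ≠ y := by
  rintro rfl
  have := h.mem_iff
  tauto

/-- Passing from `B` to `B - u + z` can destroy the edge `{x, y}` only if it spans a four-cycle with
`{u, z}`; this is what `hn` excludes. -/
lemma IsSwap.isSwap_pivot {u z x y : E} (huz : M.IsSwap B u z) (hxy : M.IsSwap B x y)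
    (hx : x ≠ u) (hy : y ≠ z) (hn : ¬ (M.IsSwap B u y ∧ M.IsSwap B x z)) :
    M.IsSwap (swap B u z) x y :=
  ⟨by simp [swap, hx, hxy.1], by simp [swap, hy, hxy.2.1],
    isBase_double_swap hx.symm hy.symm huz hxy hn⟩

lemma CrossRatioTrivial.gain_pivot (hφ : M.CrossRatioTrivial φ)
    (hB : M.toMatroid.IsBase (B : Set E)) {u z x y : E} (huz : M.IsSwap B u z)
    (hxy : M.IsSwap B x y) (hx : x ≠ u) (hy : y ≠ z)
    (hn : ¬ (M.IsSwap B u y ∧ M.IsSwap B x z)) :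
    gain φ (swap B u z) x y = gain φ B x y := by
  have h := huz.isSwap_pivot hxy hx hy hn
  rw [h.gain_eq, hxy.gain_eq, hφ.double_swap hB hx.symm huz hxy h.2.2]
  abel

/-- The hypotheses `h1` and `h2` exclude the four-cycle for the two possible positions of the edge:
`x` in `B`, respectively `y` in `B`. -/
lemma FundAdj.fundAdj_pivot {u z x y : E} (hxy : M.FundAdj B x y) (huz : M.IsSwap B u z)
    (hxu : x ≠ u) (hxz : x ≠ z) (hyu : y ≠ u) (hyz : y ≠ z)
    (h1 : ¬ M.FundAdj B u y) (h2 : ¬ (M.FundAdj B u x ∧ M.FundAdj B y z)) :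
    M.FundAdj (swap B u z) x y := by
  rcases hxy with hxy | hxy
  · exact Or.inl (huz.isSwap_pivot hxy hxu hyz fun h => h1 (Or.inl h.1))
  · exact Or.inr (huz.isSwap_pivot hxy hyu hxz fun h => h2 ⟨Or.inl h.1, Or.inl h.2⟩)

lemma CrossRatioTrivial.gain_pivot_of_fundAdj (hφ : M.CrossRatioTrivial φ)
    (hB : M.toMatroid.IsBase (B : Set E)) {u z x y : E} (hxy : M.FundAdj B x y)
    (huz : M.IsSwap B u z) (hxu : x ≠ u) (hxz : x ≠ z) (hyu : y ≠ u) (hyz : y ≠ z)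
    (h1 : ¬ M.FundAdj B u y) (h2 : ¬ (M.FundAdj B u x ∧ M.FundAdj B y z)) :
    gain φ (swap B u z) x y = gain φ B x y := by
  have h := hxy.fundAdj_pivot huz hxu hxz hyu hyz h1 h2
  rcases hxy with hxy | hxy
  · exact hφ.gain_pivot hB huz hxy hxu hyz fun h => h1 (Or.inl h.1)
  · rw [h.symm.gain_comm, (FundAdj.symm (Or.inr hxy)).gain_comm,
      hφ.gain_pivot hB huz hxy hyu hxz fun h => h2 ⟨Or.inl h.1, Or.inl h.2⟩]

/-- Pivoting at `{u, z}` creates the edge `{x, y}` from a path `y, u, z, x`. -/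
lemma IsSwap.isSwap_pivot_new {u z x y : E} (huz : M.IsSwap B u z) (huy : M.IsSwap B u y)
    (hxz : M.IsSwap B x z) (hx : x ≠ u) (hy : y ≠ z) (hn : ¬ M.IsSwap B x y) :
    M.IsSwap (swap B u z) x y :=
  ⟨by simp [swap, hx, hxz.1], by simp [swap, hy, huy.2.1], by
    rw [swap_swap_comm hxz.1 huz.2.1 huy.2.1]
    exact isBase_double_swap hx.symm hy huy hxz fun h => hn h.2⟩

lemma CrossRatioTrivial.gain_pivot_new (hφ : M.CrossRatioTrivial φ)
    (hB : M.toMatroid.IsBase (B : Set E)) {u z x y : E} (huz : M.IsSwap B u z)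
    (huy : M.IsSwap B u y) (hxz : M.IsSwap B x z) (hx : x ≠ u) (hy : y ≠ z)
    (hn : ¬ M.IsSwap B x y) :
    gain φ (swap B u z) x y = gain φ B u y + gain φ B x z - gain φ B u z := by
  have h := huz.isSwap_pivot_new huy hxz hx hy hn
  have h3 := h.2.2
  rw [swap_swap_comm hxz.1 huz.2.1 huy.2.1] at h3
  rw [h.gain_eq, huy.gain_eq, hxz.gain_eq, huz.gain_eq, swap_swap_comm hxz.1 huz.2.1 huy.2.1,
    hφ.double_swap hB hx.symm huy hxz h3]
  abel

/-- Paths of length `n` in the fundamental graph of `B` whose end points are adjacent have the same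
gain as the edge between their end points. -/
def ShortcutsTrivial (M : MatroidOn E r) (φ : Finset E → A) (B : Finset E) (n : ℕ) : Prop :=
  ∀ v : ℕ → E, (∀ i < n, M.FundAdj B (v i) (v (i + 1))) → M.FundAdj B (v 0) (v n) →
    ∑ i ∈ Finset.range n, gain φ B (v i) (v (i + 1)) = gain φ B (v 0) (v n)

section Path

variable {n : ℕ} {p : ℕ → E}

lemma fundAdj_reverse (hp : ∀ i < n, M.FundAdj B (p i) (p (i + 1))) :
    ∀ i < n, M.FundAdj B (p (n - i)) (p (n - (i + 1))) := by
  intro i hi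
  have := (hp (n - (i + 1)) (by omega)).symm
  rwa [show n - (i + 1) + 1 = n - i by omega] at this

lemma sum_gain_reverse (hp : ∀ i < n, M.FundAdj B (p i) (p (i + 1))) :
    ∑ i ∈ Finset.range n, gain φ B (p (n - i)) (p (n - (i + 1))) =
      - ∑ i ∈ Finset.range n, gain φ B (p i) (p (i + 1)) := by
  rw [← Finset.sum_range_reflect, ← Finset.sum_neg_distrib]
  refine Finset.sum_congr rfl fun i hi => ?_
  have hi := Finset.mem_range.1 hi
  rw [← (hp i hi).gain_comm, show n - (n - 1 - i) = i + 1 by omega,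
    show n - (n - 1 - i + 1) = i by omega]

/-- A chord at the initial vertex cuts the closed walk into two shorter ones: the first `i` steps
are traded for the chord, and the chord followed by the remaining steps is again a shorter path. -/
lemma sum_gain_of_chord_zero (IH : ∀ m < n, M.ShortcutsTrivial φ B m)
    (hp : ∀ i < n, M.FundAdj B (p i) (p (i + 1))) (hn : M.FundAdj B (p 0) (p n))
    {i : ℕ} (h2 : 2 ≤ i) (hi : i < n) (hc : M.FundAdj B (p 0) (p i)) :
    ∑ i ∈ Finset.range n, gain φ B (p i) (p (i + 1)) = gain φ B (p 0) (p n) := by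
  obtain ⟨m, rfl⟩ := Nat.exists_eq_add_of_lt hi
  let q : ℕ → E := fun j => Nat.casesOn j (p 0) fun j => p (i + j)
  have hq := IH (m + 1 + 1) (by omega) q (by
    intro j hj
    cases j with
    | zero => exact hc
    | succ j => exact hp (i + j) (by omega)) hn
  rw [Finset.sum_range_succ'] at hq
  rw [add_assoc, Finset.sum_range_add, IH i hi p (fun j hj => hp j (by omega)) hc, add_comm]
  exact hq

lemma sum_gain_of_chord_last (IH : ∀ m < n, M.ShortcutsTrivial φ B m)
    (hp : ∀ i < n, M.FundAdj B (p i) (p (i + 1))) (hn : M.FundAdj B (p 0) (p n))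
    {i : ℕ} (h1 : 1 ≤ i) (hi : i + 2 ≤ n) (hc : M.FundAdj B (p i) (p n)) :
    ∑ i ∈ Finset.range n, gain φ B (p i) (p (i + 1)) = gain φ B (p 0) (p n) := by
  have h := sum_gain_of_chord_zero (φ := φ) (p := fun j => p (n - j)) IH (fundAdj_reverse hp)
    (by simpa using hn.symm) (i := n - i) (by omega) (by omega)
    (by simpa [show n - (n - i) = i by omega] using hc.symm)
  rw [sum_gain_reverse hp] at h
  simp only [Nat.sub_self, Nat.sub_zero, hn.gain_comm] at h
  exact neg_injective h

/-- The chord replaces the inner path of length `n - 2`. What remains is a path of length three,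
which is covered by `IH` since `4 ≤ n`. -/
lemma sum_gain_of_chord_inner (IH : ∀ m < n, M.ShortcutsTrivial φ B m)
    (hp : ∀ i < n, M.FundAdj B (p i) (p (i + 1))) (hn : M.FundAdj B (p 0) (p n)) (h4 : 4 ≤ n)
    (hc : M.FundAdj B (p 1) (p (n - 1))) :
    ∑ i ∈ Finset.range n, gain φ B (p i) (p (i + 1)) = gain φ B (p 0) (p n) := by
  obtain ⟨m, rfl⟩ : ∃ m, n = m + 1 + 1 := ⟨n - 2, by omega⟩
  have h1 := IH m (by omega) (fun j => p (j + 1)) (fun j hj => hp (j + 1) (by omega)) hc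
  -- Only the indices `0` to `3` matter; the reduction modulo `4` merely makes the function total.
  let q : ℕ → E := ![p 0, p 1, p (m + 1), p (m + 1 + 1)] ∘ Fin.ofNat 4
  have h2 := IH 3 (by omega) q (by
    intro j hj
    interval_cases j
    · exact hp 0 (by omega)
    · exact hc
    · exact hp (m + 1) (by omega)) hn
  rw [Finset.sum_range_succ, Finset.sum_range_succ', h1]
  simp only [Finset.sum_range_succ, Finset.sum_range_zero] at h2
  change 0 + gain φ B (p 0) (p 1) + gain φ B (p 1) (p (m + 1)) +
    gain φ B (p (m + 1)) (p (m + 1 + 1)) = gain φ B (p 0) (p (m + 1 + 1)) at h2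
  rw [← h2, zero_add]
  abel

end Path

lemma CrossRatioTrivial.shortcutsTrivial_three (hφ : M.CrossRatioTrivial φ)
    (hB : M.toMatroid.IsBase (B : Set E)) : M.ShortcutsTrivial φ B 3 := by
  intro p hp hn
  have h0 := hp 0 (by omega)
  have h1 := hp 1 (by omega)
  have h2 := hp 2 (by omega)
  simp only [Finset.sum_range_succ, Finset.sum_range_zero, zero_add] at h0 ⊢
  simp only [Nat.reduceAdd] at h1 h2 ⊢
  generalize p 0 = a at *
  generalize p 1 = b at *
  generalize p 2 = c at *
  generalize p 3 = d at *
  -- If two vertices on the same side coincide, the walk backtracks and two gains cancel; otherwise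
  -- it is a genuine four-cycle.
  by_cases hac : a = c
  · subst hac
    rw [h0.gain_comm]; abel
  by_cases ha : a ∈ B
  · have hc : c ∈ B := by
      have := h0.mem_iff; have := h1.mem_iff; tauto
    have := hφ.four_cycle hB hac (h0.isSwap ha) (hn.isSwap ha) (h1.symm.isSwap hc) (h2.isSwap hc)
    rw [h1.symm.gain_comm, (h0.isSwap ha).gain_eq, (hn.isSwap ha).gain_eq,
      (h1.symm.isSwap hc).gain_eq, (h2.isSwap hc).gain_eq]
    rw [← eq_sub_iff_add_eq] at this
    rw [this]; abel
  · have hb : b ∈ B := by have := h0.mem_iff; tauto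
    have hd : d ∈ B := by have := hn.mem_iff; tauto
    by_cases hbd : b = d
    · subst hbd
      rw [h2.gain_comm]; abel
    have := hφ.four_cycle hB hbd (h0.symm.isSwap hb) (h1.isSwap hb) (hn.symm.isSwap hd)
      (h2.symm.isSwap hd)
    rw [h0.symm.gain_comm, h2.symm.gain_comm, hn.symm.gain_comm, (h0.symm.isSwap hb).gain_eq,
      (h1.isSwap hb).gain_eq, (hn.symm.isSwap hd).gain_eq, (h2.symm.isSwap hd).gain_eq]
    rw [← eq_sub_iff_add_eq] at this
    rw [this]; abel

lemma CrossRatioTrivial.shortcutsTrivial (hφ : M.CrossRatioTrivial φ) (n : ℕ) :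
    ∀ B : Finset E, M.toMatroid.IsBase (B : Set E) → M.ShortcutsTrivial φ B n := by
  induction n using Nat.strong_induction_on with
  | _ n IH =>
  intro B hB p hp hn
  -- Exactly one end point lies in `B`, and reversing the path negates both sides of the claim.
  wlog h0 : p 0 ∈ B generalizing p
  · have h := this (fun j => p (n - j)) (fundAdj_reverse hp) (by simpa using hn.symm) (by
      have := hn.mem_iff; simp only [Nat.sub_zero]; tauto)
    rw [sum_gain_reverse hp] at h
    simp only [Nat.sub_self, Nat.sub_zero, hn.gain_comm] at h
    exact neg_injective h
  have IHB : ∀ m < n, M.ShortcutsTrivial φ B m := fun m hm => IH m hm B hB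
  rcases lt_or_ge n 4 with hlt | h4
  · interval_cases n
    · exact absurd rfl hn.ne
    · simp
    -- Length two is impossible because the graph is bipartite.
    · have e0 := (hp 0 (by omega)).mem_iff
      have e1 := (hp 1 (by omega)).mem_iff
      have e2 := hn.mem_iff
      simp only [Nat.reduceAdd] at e0 e1 e2
      tauto
    · exact hφ.shortcutsTrivial_three hB p hp hn
  by_contra hne
  -- A path violating the claim has none of the chords that would reduce it to shorter paths. Other
  -- chords are harmless for the pivot below.
  have c0 : ∀ i, 2 ≤ i → i < n → ¬ M.FundAdj B (p 0) (p i) := fun i h2 hi hc =>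
    hne (sum_gain_of_chord_zero IHB hp hn h2 hi hc)
  have cn : ∀ i, 1 ≤ i → i + 2 ≤ n → ¬ M.FundAdj B (p i) (p n) := fun i h1 hi hc =>
    hne (sum_gain_of_chord_last IHB hp hn h1 hi hc)
  have c1 : ¬ M.FundAdj B (p 1) (p (n - 1)) := fun hc =>
    hne (sum_gain_of_chord_inner IHB hp hn h4 hc)
  -- A return to an end point would turn a neighbouring edge of the path into a forbidden chord.
  -- Inner vertices may repeat among themselves.
  have n0 : ∀ i, 1 ≤ i → i < n → p i ≠ p 0 := by
    intro i h1 hi h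
    obtain ⟨i, rfl⟩ : ∃ j, i = j + 1 := ⟨i - 1, by omega⟩
    rcases i with _ | _ | i
    · exact (hp 0 (by omega)).ne h.symm
    · exact c0 3 (by omega) (by omega) (h ▸ hp 2 (by omega))
    · exact c0 (i + 2) (by omega) (by omega) (h ▸ (hp (i + 2) (by omega)).symm)
  have nn : ∀ i, 1 ≤ i → i < n → p i ≠ p n := by
    intro i h1 hi h
    obtain ⟨i, rfl⟩ : ∃ j, i = j + 1 := ⟨i - 1, by omega⟩
    rcases i with _ | i
    · exact cn 2 (by omega) (by omega) (h ▸ (hp 1 (by omega)).symm)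
    · exact cn (i + 1) (by omega) (by omega) (h ▸ hp (i + 1) (by omega))
  have huz := hn.isSwap h0
  obtain ⟨m, rfl⟩ : ∃ m, n = m + 1 + 1 := ⟨n - 2, by omega⟩
  -- Pivoting at the closing edge `{p 0, p n}` keeps all inner edges together with their gains,
  -- because the missing chords prevent four-cycles with the pivot edge.
  have hpiv : ∀ j < m, M.FundAdj (swap B (p 0) (p (m + 1 + 1))) (p (j + 1)) (p (j + 1 + 1)) ∧
      gain φ (swap B (p 0) (p (m + 1 + 1))) (p (j + 1)) (p (j + 1 + 1)) =
        gain φ B (p (j + 1)) (p (j + 1 + 1)) := by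
    intro j hj
    have h2 : ¬ (M.FundAdj B (p 0) (p (j + 1)) ∧
        M.FundAdj B (p (j + 1 + 1)) (p (m + 1 + 1))) := by
      rintro ⟨h, h'⟩
      rcases j with _ | j
      · exact cn 2 (by omega) (by omega) h'
      · exact c0 (j + 1 + 1) (by omega) (by omega) h
    have a1 := n0 (j + 1) (by omega) (by omega)
    have a2 := nn (j + 1) (by omega) (by omega)
    have a3 := n0 (j + 1 + 1) (by omega) (by omega)
    have a4 := nn (j + 1 + 1) (by omega) (by omega)
    have a5 := c0 (j + 1 + 1) (by omega) (by omega)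
    exact ⟨(hp (j + 1) (by omega)).fundAdj_pivot huz a1 a2 a3 a4 a5 h2,
      hφ.gain_pivot_of_fundAdj hB (hp (j + 1) (by omega)) huz a1 a2 a3 a4 a5 h2⟩
  have f0 := hp 0 (by omega)
  have fl := hp (m + 1) (by omega)
  have hl : p (m + 1) ∈ B := by
    have := fl.mem_iff; have := huz.2.1; tauto
  have hx := n0 (m + 1) (by omega) (by omega)
  have hy := nn 1 (by omega) (by omega)
  have hxy : ¬ M.IsSwap B (p (m + 1)) (p 1) := fun h => c1 (Or.inr h)
  have hnew := huz.isSwap_pivot_new (f0.isSwap h0) (fl.isSwap hl) hx hy hxy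
  have hgain := hφ.gain_pivot_new hB huz (f0.isSwap h0) (fl.isSwap hl) hx hy hxy
  -- The inner path has length `n - 2` and is closed up by the edge that the pivot creates. The gain
  -- of that edge accounts for the three edges at `p 0` and `p n` that disappear.
  have key := IH m (by omega) _ huz.2.2 (fun j => p (j + 1)) (fun j hj => (hpiv j hj).1)
    (Or.inr hnew)
  rw [Finset.sum_congr rfl fun j hj => (hpiv j (Finset.mem_range.1 hj)).2,
    FundAdj.gain_comm (Or.inl hnew), hgain] at key
  apply hne
  rw [Finset.sum_range_succ, Finset.sum_range_succ', key]
  abel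

end MatroidOn

/-! ### Gains of walks and potentials on a graph -/

namespace SimpleGraph.Walk

variable {V : Type v} {A : Type w} [AddCommGroup A] {G : SimpleGraph V}

/-- The sum of the values of `w` at the darts of a walk. -/
def gain (w : V → V → A) : ∀ {x y : V}, G.Walk x y → A
  | _, _, .nil => 0
  | x, _, .cons (v := y) _ p => w x y + gain w p

lemma gain_append (w : V → V → A) {x y z : V} (p : G.Walk x y) (q : G.Walk y z) :
    (p.append q).gain w = p.gain w + q.gain w := by
  induction p with
  | nil => simp [gain]
  | cons h p ih => rw [cons_append, gain, gain, ih, add_assoc]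

lemma gain_reverse {w : V → V → A} (hw : ∀ x y, G.Adj x y → w y x = - w x y) {x y : V}
    (p : G.Walk x y) : p.reverse.gain w = - p.gain w := by
  induction p with
  | nil => simp [gain]
  | cons h p ih =>
    rw [reverse_cons, gain_append, ih, gain, gain, gain, hw _ _ h]
    abel

lemma gain_eq_sum (w : V → V → A) {x y : V} (p : G.Walk x y) :
    p.gain w = ∑ i ∈ Finset.range p.length, w (p.getVert i) (p.getVert (i + 1)) := by
  induction p with
  | nil => simp [gain]
  | cons h p ih =>
    rw [gain, ih, length_cons, Finset.sum_range_succ', add_comm]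
    simp

/-- A gain function for which all closed walks are trivial has a potential. -/
lemma exists_potential {w : V → V → A} (hw : ∀ x y, G.Adj x y → w y x = - w x y)
    (h : ∀ (x : V) (p : G.Walk x x), p.gain w = 0) :
    ∃ t : V → A, ∀ x y, G.Adj x y → w x y = t y - t x := by
  -- The potential at `x` is the gain of a chosen walk to `x` from a chosen vertex of its component.
  have hr : ∀ x, G.Reachable (G.connectedComponentMk x).out x := fun x =>
    SimpleGraph.ConnectedComponent.exact (Quot.out_eq (G.connectedComponentMk x))
  let p := fun x => (hr x).some
  refine ⟨fun x => (p x).gain w, fun x y hxy => ?_⟩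
  have hc : G.connectedComponentMk y = G.connectedComponentMk x :=
    (SimpleGraph.ConnectedComponent.sound hxy.reachable).symm
  have key : ∀ q : G.Walk (G.connectedComponentMk x).out y, w x y = q.gain w - (p x).gain w := by
    intro q
    have := h _ (((p x).append (cons hxy nil)).append q.reverse)
    rw [gain_append, gain_append, gain_reverse hw, gain, gain, add_zero] at this
    rw [eq_sub_iff_add_eq, ← sub_eq_zero, ← this]
    abel
  -- The walk `p y` starts at the representative chosen for the component of `y`. The component is
  -- generalized so that it can be identified with that of `x` inside the type of the walk.
  have key' : ∀ (c : G.ConnectedComponent) (_ : c = G.connectedComponentMk x) (q : G.Walk c.out y),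
      w x y = q.gain w - (p x).gain w := by
    rintro _ rfl
    exact key
  exact key' _ hc (p y)

end SimpleGraph.Walk

/-! ### Functions on bases with trivial cross ratios -/

namespace MatroidOn

variable {E : Type v} [LinearOrder E] {r : ℕ} {A : Type w} [AddCommGroup A]
variable {M : MatroidOn E r} {φ : Finset E → A} {B : Finset E}

/-- The fundamental graph of `B`. -/
def fundGraph (M : MatroidOn E r) (B : Finset E) : SimpleGraph E where
  Adj := M.FundAdj B
  symm := ⟨fun _ _ h => h.symm⟩
  loopless := ⟨fun _ h => h.ne rfl⟩

lemma CrossRatioTrivial.exists_potential (hφ : M.CrossRatioTrivial φ)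
    (hB : M.toMatroid.IsBase (B : Set E)) :
    ∃ t : E → A, ∀ b e, M.IsSwap B b e → φ (swap B b e) - φ B = t e - t b := by
  obtain ⟨t, ht⟩ := SimpleGraph.Walk.exists_potential (G := M.fundGraph B) (w := gain φ B)
    (fun x y (h : M.FundAdj B x y) => h.gain_comm) (by
      intro x p
      cases p with
      | nil => rfl
      | cons h p =>
        -- Without its first edge, a closed walk is a path whose end points are adjacent.
        have h : M.FundAdj B _ _ := h
        have hp := hφ.shortcutsTrivial p.length B hB p.getVert
          (fun i hi => p.adj_getVert_succ hi) (by simpa using h.symm)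
        rw [SimpleGraph.Walk.gain, SimpleGraph.Walk.gain_eq_sum, hp]
        simp [h.gain_comm])
  exact ⟨t, fun b e h => by rw [← ht b e (Or.inl h), h.gain_eq]⟩

/-- If `φ` vanishes at a basis `B` and its neighbours, then also at the neighbours of those. -/
lemma CrossRatioTrivial.eq_zero_of_swap (hφ : M.CrossRatioTrivial φ)
    (hB : M.toMatroid.IsBase (B : Set E)) (h0 : φ B = 0)
    (h1 : ∀ b e, M.IsSwap B b e → φ (swap B b e) = 0) {u z : E} (huz : M.IsSwap B u z) {x y : E}
    (hxy : M.IsSwap (swap B u z) x y) : φ (swap (swap B u z) x y) = 0 := by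
  obtain ⟨hx, hy, h⟩ := hxy
  have hu := huz.1
  have hz := huz.2.1
  simp only [swap, Finset.mem_insert, Finset.mem_erase, not_or, not_and] at hx hy
  -- Two successive exchanges return to `B`, amount to a single exchange, or form a true double
  -- exchange. Only the last case needs cross ratios.
  have hB' : swap (swap B u z) x y = B ∨
      (∃ b e, b ∈ B ∧ e ∉ B ∧ swap (swap B u z) x y = swap B b e) ∨
        (x ∈ B ∧ x ≠ u ∧ y ∉ B ∧ y ≠ z) := by
    by_cases hxz : x = z
    · subst hxz
      have he : swap (swap B u x) x y = insert y (B.erase u) := by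
        simp [swap, hz]
      by_cases hyu : y = u
      · subst hyu; exact Or.inl (by rw [he, Finset.insert_erase hu])
      · exact Or.inr (Or.inl ⟨u, y, hu, hy.2 hyu, he⟩)
    · have hx' := hx.resolve_left hxz
      by_cases hyu : y = u
      · subst hyu
        refine Or.inr (Or.inl ⟨x, z, hx'.2, hz, ?_⟩)
        ext a; simp only [swap, Finset.mem_insert, Finset.mem_erase]; grind
      · exact Or.inr (Or.inr ⟨hx'.2, hx'.1, hy.2 hyu, hy.1⟩)
  rcases hB' with hB' | ⟨b, e, hb, he, hbe⟩ | ⟨hx, hxu, hy, hyz⟩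
  · rw [hB', h0]
  · rw [hbe]
    exact h1 b e ⟨hb, he, hbe ▸ h⟩
  · rcases isSwap_of_double_swap hxu.symm hyz.symm hu hx hz hy hB h with ⟨h2, h3⟩ | ⟨h2, h3⟩
    · rw [hφ.double_swap hB hxu.symm h2 h3 h, h1 _ _ h2, h1 _ _ h3, h0]
      simp
    -- Here the double exchange splits into the crossed exchanges, so the two new elements trade
    -- roles.
    · rw [swap_swap_comm hx hz hy] at h ⊢
      rw [hφ.double_swap hB hxu.symm h2 h3 h, h1 _ _ h2, h1 _ _ h3, h0]
      simp

/-- The condition "zero at a basis and its neighbours" is inherited by each neighbour. Basis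
exchange therefore carries it step by step towards `C`, lowering the size of `B \ C`. -/
lemma CrossRatioTrivial.eq_zero (hφ : M.CrossRatioTrivial φ) {C : Finset E}
    (hC : M.toMatroid.IsBase (C : Set E)) (n : ℕ) : ∀ B : Finset E, (B \ C).card = n →
    M.toMatroid.IsBase (B : Set E) → φ B = 0 →
    (∀ b e, M.IsSwap B b e → φ (swap B b e) = 0) → φ C = 0 := by
  induction n with
  | zero =>
    intro B hn hB h0 _
    have hs := Finset.sdiff_eq_empty_iff_subset.1 (Finset.card_eq_zero.1 hn)
    rw [← Finset.coe_inj.1 (hB.eq_of_subset_isBase hC (Finset.coe_subset.2 hs)), h0]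
  | succ n ih =>
    intro B hn hB h0 h1
    obtain ⟨u, hu⟩ := Finset.card_pos.1 (by omega : 0 < (B \ C).card)
    obtain ⟨huB, huC⟩ := Finset.mem_sdiff.1 hu
    obtain ⟨z, ⟨hzC, hzB⟩, hz⟩ := hB.exchange hC (e := u) ⟨huB, huC⟩
    have huz : M.IsSwap B u z := ⟨huB, hzB, by simpa [swap] using hz⟩
    refine ih (swap B u z) ?_ huz.2.2 (h1 _ _ huz)
      (fun b e h => hφ.eq_zero_of_swap hB h0 h1 huz h)
    have : swap B u z \ C = (B \ C).erase u := by
      have hzC : z ∈ C := hzC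
      ext a; simp only [swap, Finset.mem_sdiff, Finset.mem_insert, Finset.mem_erase]; grind
    rw [this, Finset.card_erase_of_mem hu, hn]
    rfl

lemma exists_base [Finite E] (M : MatroidOn E r) : Nonempty M.Bases := by
  obtain ⟨B, hB⟩ := M.toMatroid.exists_isBase
  refine ⟨⟨B.toFinite.toFinset, ?_⟩⟩
  rwa [Set.Finite.coe_toFinset]

/-- A basis has exactly `r` elements, which leaves no room for coincidences. Cross ratio indices
carry no such conditions explicitly. -/
lemma disjoint_pair_of_isBase {I : Finset E} {a b : E} (hI : I.card + 2 = r)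
    (h : M.toMatroid.IsBase ((I ∪ {a, b} : Finset E) : Set E)) : a ≠ b ∧ a ∉ I ∧ b ∉ I := by
  have hc := M.card_base ⟨_, h⟩
  have hab : a ≠ b := by
    rintro rfl
    have := Finset.card_union_le I {a, a}
    simp only [Finset.pair_eq_singleton, Finset.card_singleton] at this hc
    omega
  have hd : Disjoint I {a, b} := by
    rw [← Finset.card_union_eq_card_add_card, hc, Finset.card_pair hab, hI]
  exact ⟨hab, by simpa using hd⟩

/-- A function on the bases of `M` all of whose cross ratios are trivial comes from the torus. -/
theorem CrossRatioTrivial.exists_eq_add_sum [Finite E] (hφ : M.CrossRatioTrivial φ) :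
    ∃ (a : A) (t : E → A), ∀ B : Finset E, M.toMatroid.IsBase (B : Set E) →
      φ B = a + ∑ j ∈ B, t j := by
  obtain ⟨B₀, hB₀⟩ := M.exists_base
  obtain ⟨t, ht⟩ := hφ.exists_potential hB₀
  -- The constant is normalized so that the difference `ψ` vanishes at `B₀`; the potential makes it
  -- vanish at the neighbours of `B₀`.
  refine ⟨φ B₀ - ∑ j ∈ B₀, t j, t, fun C hC => ?_⟩
  let ψ : Finset E → A := fun B => φ B - (φ B₀ - ∑ j ∈ B₀, t j + ∑ j ∈ B, t j)
  have hsum : ∀ (I : Finset E) (a b : E), I.card + 2 = r →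
      M.toMatroid.IsBase ((I ∪ {a, b} : Finset E) : Set E) →
      ∑ j ∈ I ∪ {a, b}, t j = ∑ j ∈ I, t j + (t a + t b) := by
    intro I a b hI hb
    obtain ⟨hab, ha, hb⟩ := disjoint_pair_of_isBase hI hb
    have hd : Disjoint I {a, b} := by simp [ha, hb]
    rw [Finset.sum_union hd, Finset.sum_pair hab]
  have hψ : M.CrossRatioTrivial ψ := by
    intro I a b c d hI h1 h2 h3 h4
    have := hφ I a b c d hI h1 h2 h3 h4
    simp only [ψ, hsum I _ _ hI h1, hsum I _ _ hI h2, hsum I _ _ hI h3, hsum I _ _ hI h4]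
    rw [← eq_sub_iff_add_eq] at this
    rw [this]
    abel
  refine sub_eq_zero.1 (hψ.eq_zero hC _ B₀ rfl hB₀ (by simp [ψ]) fun b e h => ?_)
  have h1 := ht b e h
  have h2 : ∑ j ∈ swap B₀ b e, t j = t e + (∑ j ∈ B₀, t j - t b) := by
    rw [swap, Finset.sum_insert (by simp [h.2.1]), ← Finset.add_sum_erase _ _ h.1]
    abel
  rw [sub_eq_iff_eq_add] at h1
  simp only [ψ, h1, h2]
  abel

end MatroidOn

/-! ### Cross ratios lie in the foundation -/

/-- A property of four distinct elements that is invariant under permutations needs to be verified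
only for elements in increasing order. -/
lemma forall_distinct_of_forall_lt {E : Type v} [LinearOrder E] {P : E → E → E → E → Prop}
    (s₁ : ∀ a b c d, P a b c d → P b a c d) (s₂ : ∀ a b c d, P a b c d → P a c b d)
    (s₃ : ∀ a b c d, P a b c d → P a b d c) {S : Set E}
    (h : ∀ a ∈ S, ∀ b ∈ S, ∀ c ∈ S, ∀ d ∈ S, a < b → b < c → c < d → P a b c d)
    {a b c d : E} (ha : a ∈ S) (hb : b ∈ S) (hc : c ∈ S) (hd : d ∈ S)
    (hab : a ≠ b) (hac : a ≠ c) (had : a ≠ d) (hbc : b ≠ c) (hbd : b ≠ d) (hcd : c ≠ d) :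
    P a b c d := by
  wlog h1 : a < b generalizing a b
  · exact s₁ _ _ _ _ (this hb ha hab.symm hbc hbd hac had (lt_of_le_of_ne (not_lt.1 h1) hab.symm))
  wlog h2 : c < d generalizing c d
  · exact s₃ _ _ _ _ (this hd hc hcd.symm had hac hbd hbc
      (lt_of_le_of_ne (not_lt.1 h2) hcd.symm))
  wlog h3 : a < c generalizing a b c d
  · exact s₂ _ _ _ _ (s₁ _ _ _ _ (s₃ _ _ _ _ (s₂ _ _ _ _ (this hc hd hcd h2 ha hb hab
      hac.symm hbc.symm had.symm hbd.symm h1 (lt_of_le_of_ne (not_lt.1 h3) hac.symm)))))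
  rcases lt_or_gt_of_ne hbc with h4 | h4
  · exact h a ha b hb c hc d hd h1 h4 h2
  · refine s₂ _ _ _ _ ?_
    rcases lt_or_gt_of_ne hbd with h5 | h5
    · exact h a ha c hc b hb d hd h3 h4 h5
    · exact s₃ _ _ _ _ (h a ha c hc d hd b hb h3 h2 h5)

namespace Pasture

variable (F : Pasture.{u})

lemma eps_mem_foundationUnits : F.eps ∈ F.foundationUnits := F.eps_mem_foundationMonoid

/-- Dividing the relation by `b` turns its second term into `1` and exhibits `a / b` as fundamental.
-/
lemma div_mem_foundationUnits {a b : F.Units} {c : F.Elem}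
    (h : inc (a : F.Elem) + inc (b : F.Elem) + inc c ∈ F.null) : a / b ∈ F.foundationUnits := by
  refine Submonoid.subset_closure ⟨((b⁻¹ : F.Units) : F.Elem) * c, 0, ?_⟩
  have h' := F.null.mul_mem_left (inc ((b⁻¹ : F.Units) : F.Elem)) h
  rw [mul_add, mul_add, ← FormalSum.inc_mul, ← FormalSum.inc_mul, ← FormalSum.inc_mul,
    ← WithZero.coe_mul, ← WithZero.coe_mul, inv_mul_cancel, inv_mul_eq_div] at h'
  rw [add_right_comm, Fin.val_zero, pow_zero]
  exact h'

end Pasture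

namespace WeakGP

variable {E : Type v} [LinearOrder E] {r : ℕ} {M : MatroidOn E r} {F : Pasture.{u}}

open Classical in
/-- The extension by zero of a weak Grassmann-Plücker function to all finite subsets of `E`. -/
def val (Δ : WeakGP M F) (S : Finset E) : F.Elem :=
  if h : S ∈ Set.powersetCard E r then Δ.toFun ⟨S, h⟩ else 0

lemma val_coe (Δ : WeakGP M F) (J : Set.powersetCard E r) : Δ.val J.1 = Δ.toFun J :=
  dif_pos J.2

lemma val_base (Δ : WeakGP M F) (B : M.Bases) : Δ.val B.1 = (Δ.unit B : F.Elem) := by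
  rw [coe_unit]
  exact Δ.val_coe B.toSet

/-- A three-term relation, with coefficients in the foundation, for elements in arbitrary order. -/
def ThreeTerm (Δ : WeakGP M F) (I : Finset E) (a b c d : E) : Prop :=
  ∃ s₁ ∈ F.foundationUnits, ∃ s₂ ∈ F.foundationUnits, ∃ s₃ ∈ F.foundationUnits,
    inc ((s₁ : F.Elem) * (Δ.val (I ∪ {a, b}) * Δ.val (I ∪ {c, d}))) +
    inc ((s₂ : F.Elem) * (Δ.val (I ∪ {a, c}) * Δ.val (I ∪ {b, d}))) +
    inc ((s₃ : F.Elem) * (Δ.val (I ∪ {a, d}) * Δ.val (I ∪ {b, c}))) ∈ F.null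

lemma threeTerm_of_lt (Δ : WeakGP M F) {I : Finset E} (hI : I.card + 2 = r) {a b c d : E}
    (ha : a ∉ I) (hb : b ∉ I) (hc : c ∉ I) (hd : d ∉ I) (hab : a < b) (hbc : b < c)
    (hcd : c < d) : Δ.ThreeTerm I a b c d := by
  let Q : PluckerIndex E r := ⟨I, hI, ![a, b, c, d], by
    refine Fin.strictMono_iff_lt_succ.2 fun i => ?_
    fin_cases i
    exacts [hab, hbc, hcd], by
    intro k
    fin_cases k
    exacts [ha, hb, hc, hd]⟩
  refine ⟨1, one_mem _, F.eps, F.eps_mem_foundationUnits, 1, one_mem _, ?_⟩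
  have h := Δ.plucker Q
  unfold PluckerIndex.sum at h
  simp only [← val_coe] at h
  rw [mul_assoc] at h
  rw [WithZero.coe_one, one_mul, one_mul]
  exact h

/-- Transposing two adjacent indices only permutes the three products. Letting the coefficients be
arbitrary foundation units avoids tracking where `ε` ends up. -/
lemma threeTerm (Δ : WeakGP M F) {I : Finset E} (hI : I.card + 2 = r) {a b c d : E}
    (ha : a ∉ I) (hb : b ∉ I) (hc : c ∉ I) (hd : d ∉ I)
    (hab : a ≠ b) (hac : a ≠ c) (had : a ≠ d) (hbc : b ≠ c) (hbd : b ≠ d) (hcd : c ≠ d) :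
    Δ.ThreeTerm I a b c d := by
  refine forall_distinct_of_forall_lt (P := Δ.ThreeTerm I) (S := {x | x ∉ I}) ?_ ?_ ?_
    (fun a ha b hb c hc d hd => Δ.threeTerm_of_lt hI ha hb hc hd) ha hb hc hd
    hab hac had hbc hbd hcd
  · rintro a b c d ⟨s₁, h₁, s₂, h₂, s₃, h₃, h⟩
    refine ⟨s₁, h₁, s₃, h₃, s₂, h₂, ?_⟩
    rw [Finset.pair_comm b a, mul_comm (Δ.val (I ∪ {b, c})), mul_comm (Δ.val (I ∪ {b, d})),
      add_right_comm]
    exact h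
  · rintro a b c d ⟨s₁, h₁, s₂, h₂, s₃, h₃, h⟩
    refine ⟨s₂, h₂, s₁, h₁, s₃, h₃, ?_⟩
    rw [Finset.pair_comm c b, add_comm (inc _) (inc _)]
    exact h
  · rintro a b c d ⟨s₁, h₁, s₂, h₂, s₃, h₃, h⟩
    refine ⟨s₁, h₁, s₃, h₃, s₂, h₂, ?_⟩
    rw [Finset.pair_comm d c, add_right_comm]
    exact h

lemma crossRatio_mem_foundationUnits (Δ : WeakGP M F) (q : CrossRatioIndex M) :
    Δ.crossRatio q ∈ F.foundationUnits := by
  obtain ⟨I, hI, a, b, c, d, hab, hbc, hcd, hda⟩ := q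
  obtain ⟨nab, ha, hb⟩ := MatroidOn.disjoint_pair_of_isBase hI hab
  obtain ⟨ncd, hc, hd⟩ := MatroidOn.disjoint_pair_of_isBase hI hcd
  have nbc := (MatroidOn.disjoint_pair_of_isBase hI hbc).1
  have nda := (MatroidOn.disjoint_pair_of_isBase hI hda).1
  have heq : ∀ {B B' : M.Bases}, B.1 = B'.1 → Δ.unit B = Δ.unit B' := fun h =>
    congrArg Δ.unit (Subtype.ext h)
  unfold crossRatio
  -- The index set allows opposite elements to coincide; the cross ratio is then `1`.
  by_cases hac : a = c
  · subst hac
    convert one_mem F.foundationUnits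
    rw [div_eq_one]
    exact congrArg₂ _ (heq (by simp [Finset.pair_comm])) (heq (by simp [Finset.pair_comm]))
  by_cases hbd : b = d
  · subst hbd
    convert one_mem F.foundationUnits
    rw [div_eq_one, mul_comm]
    exact congrArg₂ _ (heq (by simp [Finset.pair_comm])) (heq (by simp [Finset.pair_comm]))
  obtain ⟨s₁, h₁, s₂, h₂, s₃, h₃, h⟩ :=
    Δ.threeTerm hI ha hb hc hd nab hac nda.symm nbc hbd ncd
  rw [Finset.pair_comm a d, add_right_comm, mul_comm (Δ.val (I ∪ {d, a}))] at h
  have v1 := Δ.val_base ⟨_, hab⟩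
  have v2 := Δ.val_base ⟨_, hbc⟩
  have v3 := Δ.val_base ⟨_, hcd⟩
  have v4 := Δ.val_base ⟨_, hda⟩
  rw [v1, v2, v3, v4, ← WithZero.coe_mul, ← WithZero.coe_mul, ← WithZero.coe_mul,
    ← WithZero.coe_mul] at h
  -- The quotient of two terms is the cross ratio times `s₁ / s₃`, and this factor is removed within
  -- the foundation.
  have h' := mul_mem (F.div_mem_foundationUnits h) (div_mem h₃ h₁)
  rwa [mul_div_mul_comm, mul_right_comm, div_mul_div_cancel, div_self', one_mul] at h'

end WeakGP

/-! ### Short null sums, and generators of the foundation -/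

namespace FormalSum

variable {G : Type u} [CommGroup G]

/-- The multiset of summands of a formal sum. -/
def terms (s : MonoidAlgebra ℕ G) : Multiset G := Finsupp.toMultiset s.coeff

@[simp] lemma terms_add (s t : MonoidAlgebra ℕ G) : terms (s + t) = terms s + terms t := by
  rw [terms, MonoidAlgebra.coeff_add, map_add]; rfl

@[simp] lemma terms_zero : terms (0 : MonoidAlgebra ℕ G) = 0 := by simp [terms]

@[simp] lemma terms_of (g : G) : terms (MonoidAlgebra.of ℕ G g) = {g} := toMultiset_of g

lemma terms_injective {s t : MonoidAlgebra ℕ G} (h : terms s = terms t) : s = t :=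
  ext_toMultiset h

lemma terms_nsmul (n : ℕ) (s : MonoidAlgebra ℕ G) : terms (n • s) = n • terms s := by
  induction n with
  | zero => simp
  | succ n ih => rw [succ_nsmul, succ_nsmul, terms_add, ih]

lemma terms_of_mul (g : G) (s : MonoidAlgebra ℕ G) :
    terms (MonoidAlgebra.of ℕ G g * s) = (terms s).map (g * ·) := by
  induction s using MonoidAlgebra.induction_on with
  | of h => rw [← map_mul, terms_of, terms_of, Multiset.map_singleton]
  | add x y hx hy => rw [mul_add, terms_add, hx, hy, terms_add, Multiset.map_add]
  | smul n x hx => rw [mul_smul_comm, terms_nsmul, terms_nsmul, hx, Multiset.map_nsmul]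

lemma mem_terms_inc {a : WithZero G} {g : G} : g ∈ terms (inc a) ↔ a = g := by
  induction a using WithZero.recZeroCoe with
  | zero => simp
  | coe a => rw [inc_coe, terms_of, Multiset.mem_singleton, WithZero.coe_inj, eq_comm]

lemma card_terms_inc_le (a : WithZero G) : (terms (inc a)).card ≤ 1 := by
  induction a using WithZero.recZeroCoe with
  | zero => simp
  | coe a => rw [inc_coe, terms_of, Multiset.card_singleton]

end FormalSum

open FormalSum (terms)

namespace Pasture

variable (F : Pasture.{u}) (K : Subgroup F.Units)

/-- A null sum with a single summand could be divided by it, putting `1` in the nullset. -/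
lemma two_le_card_terms {s : MonoidAlgebra ℕ F.Units} (hs : s ∈ F.null) (h0 : terms s ≠ 0) :
    2 ≤ (terms s).card := by
  by_contra h
  have h1 : (terms s).card = 1 := by
    have := Multiset.card_pos.2 h0
    omega
  obtain ⟨a, ha⟩ := Multiset.card_eq_one.1 h1
  rw [← FormalSum.terms_of] at ha
  rw [FormalSum.terms_injective ha] at hs
  have := F.null.mul_mem_left (MonoidAlgebra.of ℕ F.Units a⁻¹) hs
  rw [← map_mul, inv_mul_cancel, map_one] at this
  exact F.one_notMem this

/-- The ideal of all formal sums in the nullset which either have at least four summands or whose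
summands lie in a single coset of `K`. -/
def cosetIdeal : Ideal (MonoidAlgebra ℕ F.Units) :=
  let P : AddSubmonoid (MonoidAlgebra ℕ F.Units) :=
    { carrier := {s | s ∈ F.null ∧
        (4 ≤ (terms s).card ∨ ∀ x ∈ terms s, ∀ y ∈ terms s, x / y ∈ K)}
      zero_mem' := ⟨zero_mem _, Or.inr (by simp)⟩
      add_mem' := by
        rintro s t ⟨hs, hs'⟩ ⟨ht, ht'⟩
        refine ⟨add_mem hs ht, ?_⟩
        by_cases hs0 : terms s = 0
        · simpa [hs0] using ht'
        by_cases ht0 : terms t = 0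
        · simpa [ht0] using hs'
        -- Two nonzero null sums have at least two summands each, so adding them never requires a
        -- comparison of cosets.
        have := F.two_le_card_terms hs hs0
        have := F.two_le_card_terms ht ht0
        left
        rw [FormalSum.terms_add, Multiset.card_add]
        omega }
  { P with
    smul_mem' := by
      intro c s hs
      change c * s ∈ P
      induction c using MonoidAlgebra.induction_on with
      | of g =>
        refine ⟨F.null.mul_mem_left _ hs.1, ?_⟩
        rw [FormalSum.terms_of_mul, Multiset.card_map]
        refine hs.2.imp_right fun h x hx y hy => ?_
        obtain ⟨x', hx', rfl⟩ := Multiset.mem_map.1 hx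
        obtain ⟨y', hy', rfl⟩ := Multiset.mem_map.1 hy
        rw [mul_div_mul_left_eq_div]
        exact h x' hx' y' hy'
      | add x y hx hy => rw [add_mul]; exact add_mem hx hy
      | smul n x hx => rw [smul_mul_assoc]; exact nsmul_mem hx n }

variable {F K}

lemma mem_cosetIdeal {s : MonoidAlgebra ℕ F.Units} : s ∈ F.cosetIdeal K ↔ s ∈ F.null ∧
    (4 ≤ (terms s).card ∨ ∀ x ∈ terms s, ∀ y ∈ terms s, x / y ∈ K) := Iff.rfl

lemma exists_units_of_mul_eq {a b : F.Elem} {x : F.Units} (h : a * b = x) :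
    ∃ y z : F.Units, a = y ∧ b = z ∧ y * z = x := by
  have h0 : a * b ≠ 0 := h ▸ WithZero.coe_ne_zero
  obtain ⟨y, rfl⟩ := WithZero.ne_zero_iff_exists.1 (left_ne_zero_of_mul h0)
  obtain ⟨z, rfl⟩ := WithZero.ne_zero_iff_exists.1 (right_ne_zero_of_mul h0)
  exact ⟨y, z, rfl, rfl, WithZero.coe_inj.1 h⟩

/-- A relation `a + b + ε ^ i` is too short for the alternative of four summands. Hence `a` lies in
the coset of `ε ^ i`, which is `K` itself. -/
lemma foundationUnits_le_of_null_le (he : F.eps ∈ K) (h : F.null ≤ F.cosetIdeal K) :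
    F.foundationUnits ≤ K := by
  suffices ∀ a ∈ F.foundationMonoid, ∀ x : F.Units, a = x → x ∈ K from
    fun x hx => this _ hx x rfl
  intro a ha
  induction ha using Submonoid.closure_induction with
  | one =>
    intro x hx
    rw [← WithZero.coe_one, WithZero.coe_inj] at hx
    exact hx ▸ one_mem _
  | mul a b _ _ ha hb =>
    intro x hx
    obtain ⟨y, z, hy, hz, rfl⟩ := exists_units_of_mul_eq hx
    exact mul_mem (ha y hy) (hb z hz)
  | mem a ha =>
    rintro x rfl
    obtain ⟨b, i, hb⟩ := ha
    have hx := (mem_cosetIdeal.1 (h hb)).2.resolve_left (by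
      have := FormalSum.card_terms_inc_le b
      simp only [FormalSum.terms_add, Multiset.card_add, FormalSum.terms_of,
        FormalSum.inc_coe, Multiset.card_singleton]
      omega) x (by
          simp only [FormalSum.terms_add, Multiset.mem_add, FormalSum.mem_terms_inc, true_or])
        (F.eps ^ (i : ℕ)) (by
          simp only [FormalSum.terms_add, Multiset.mem_add, FormalSum.terms_of,
            Multiset.mem_singleton, or_true])
    simpa using mul_mem hx (pow_mem he i)

end Pasture

namespace WeakGP

variable {E : Type v} [LinearOrder E] {r : ℕ} {M : MatroidOn E r} {F : Pasture.{u}}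
  {K : Subgroup F.Units}

lemma isBase_of_val_eq (Δ : WeakGP M F) {S : Finset E} {x : F.Units} (h : Δ.val S = x) :
    M.toMatroid.IsBase (S : Set E) := by
  unfold val at h
  split_ifs at h with hS
  · exact (Δ.support ⟨S, hS⟩).1 (h ▸ WithZero.coe_ne_zero)
  · exact absurd h.symm WithZero.coe_ne_zero

lemma unit_eq_of_val_eq (Δ : WeakGP M F) {B : M.Bases} {x : F.Units} (h : Δ.val B.1 = x) :
    Δ.unit B = x :=
  WithZero.coe_inj.1 (by rw [← val_base, h])

lemma div_mem_of_crossRatio_mem (Δ : WeakGP M F) (hK : ∀ q, Δ.crossRatio q ∈ K) {I : Finset E}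
    (hI : I.card + 2 = r) {a b c d : E} {x y z w : F.Units} (hx : Δ.val (I ∪ {a, b}) = x)
    (hy : Δ.val (I ∪ {c, d}) = y) (hz : Δ.val (I ∪ {b, c}) = z) (hw : Δ.val (I ∪ {d, a}) = w) :
    x * y / (z * w) ∈ K := by
  have h := hK ⟨I, hI, a, b, c, d, Δ.isBase_of_val_eq hx, Δ.isBase_of_val_eq hz,
    Δ.isBase_of_val_eq hy, Δ.isBase_of_val_eq hw⟩
  rwa [crossRatio, Δ.unit_eq_of_val_eq hx, Δ.unit_eq_of_val_eq hy, Δ.unit_eq_of_val_eq hz,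
    Δ.unit_eq_of_val_eq hw] at h

/-- If two of the three terms are nonzero, the four subsets involved are bases and the quotient of
the terms is a cross ratio, up to a factor `ε`. Zero terms contribute no summands. -/
lemma sum_mem_cosetIdeal (Δ : WeakGP M F) (he : F.eps ∈ K) (hK : ∀ q, Δ.crossRatio q ∈ K)
    (Q : PluckerIndex E r) : Q.sum F.eps Δ.toFun ∈ F.cosetIdeal K := by
  refine ⟨Δ.plucker Q, Or.inr ?_⟩
  have hv : ∀ k l (h : k ≠ l), Δ.toFun (Q.set k l h) = Δ.val (Q.I ∪ {Q.i k, Q.i l}) :=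
    fun k l h => (Δ.val_coe _).symm
  have pc : ∀ k l, Q.I ∪ {Q.i k, Q.i l} = Q.I ∪ {Q.i l, Q.i k} :=
    fun k l => by rw [Finset.pair_comm]
  have ac : ∀ x y : F.Units, Δ.toFun (Q.set 0 1) * Δ.toFun (Q.set 2 3) = x →
      Δ.toFun (Q.set 0 3) * Δ.toFun (Q.set 1 2) = y → x / y ∈ K := by
    intro x y hx hy
    obtain ⟨x₁, x₂, h₁, h₂, rfl⟩ := Pasture.exists_units_of_mul_eq hx
    obtain ⟨x₃, x₄, h₃, h₄, rfl⟩ := Pasture.exists_units_of_mul_eq hy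
    rw [hv] at h₁ h₂ h₃ h₄
    rw [pc] at h₃
    rw [mul_comm x₃]
    exact Δ.div_mem_of_crossRatio_mem hK Q.card_add_two h₁ h₂ h₄ h₃
  have ab : ∀ x y : F.Units, Δ.toFun (Q.set 0 1) * Δ.toFun (Q.set 2 3) = x →
      (F.eps : F.Elem) * Δ.toFun (Q.set 0 2) * Δ.toFun (Q.set 1 3) = y → x / y ∈ K := by
    intro x y hx hy
    obtain ⟨x₁, x₂, h₁, h₂, rfl⟩ := Pasture.exists_units_of_mul_eq hx
    rw [mul_assoc] at hy
    obtain ⟨e, x₅, h₅, hy', rfl⟩ := Pasture.exists_units_of_mul_eq hy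
    rw [WithZero.coe_inj] at h₅
    subst h₅
    obtain ⟨x₃, x₄, h₃, h₄, rfl⟩ := Pasture.exists_units_of_mul_eq hy'
    rw [hv] at h₁ h₂ h₃ h₄
    rw [pc] at h₁ h₄
    rw [mul_comm F.eps, ← div_div]
    exact div_mem (Δ.div_mem_of_crossRatio_mem hK Q.card_add_two h₁ h₂ h₃ h₄) he
  have cb : ∀ x y : F.Units, Δ.toFun (Q.set 0 3) * Δ.toFun (Q.set 1 2) = x →
      (F.eps : F.Elem) * Δ.toFun (Q.set 0 2) * Δ.toFun (Q.set 1 3) = y → x / y ∈ K := by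
    intro x y hx hy
    obtain ⟨x₁, x₂, h₁, h₂, rfl⟩ := Pasture.exists_units_of_mul_eq hx
    rw [mul_assoc] at hy
    obtain ⟨e, x₅, h₅, hy', rfl⟩ := Pasture.exists_units_of_mul_eq hy
    rw [WithZero.coe_inj] at h₅
    subst h₅
    obtain ⟨x₃, x₄, h₃, h₄, rfl⟩ := Pasture.exists_units_of_mul_eq hy'
    rw [hv] at h₁ h₂ h₃ h₄
    rw [pc] at h₃ h₄
    rw [mul_comm F.eps, ← div_div, mul_comm x₃]
    exact div_mem (Δ.div_mem_of_crossRatio_mem hK Q.card_add_two h₁ h₂ h₄ h₃) he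
  have self : ∀ (a : F.Elem) (x y : F.Units), a = x → a = y → x / y ∈ K := by
    rintro _ x y rfl h
    rw [WithZero.coe_inj.1 h, div_self']
    exact one_mem _
  have inv : ∀ x y : F.Units, y / x ∈ K → x / y ∈ K := fun x y h => by
    rw [← inv_div]; exact inv_mem h
  intro x hx y hy
  simp only [PluckerIndex.sum, FormalSum.terms_add, Multiset.mem_add,
    FormalSum.mem_terms_inc] at hx hy
  rcases hx with (hx | hx) | hx <;> rcases hy with (hy | hy) | hy
  · exact self _ _ _ hx hy
  · exact ab _ _ hx hy
  · exact ac _ _ hx hy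
  · exact inv _ _ (ab _ _ hy hx)
  · exact self _ _ _ hx hy
  · exact inv _ _ (cb _ _ hy hx)
  · exact inv _ _ (ac _ _ hy hx)
  · exact cb _ _ hx hy
  · exact self _ _ _ hx hy

end WeakGP

/-! ### The universal weak Grassmann-Plücker function -/

namespace PluckerIndex

variable {E : Type v} [LinearOrder E] {r : ℕ} {G : Type u} [CommGroup G]

lemma sum_mul_left (Q : PluckerIndex E r) (ε : G) (a : WithZero G)
    (Δ : Set.powersetCard E r → WithZero G) :
    Q.sum ε (fun J => a * Δ J) = inc (a * a) * Q.sum ε Δ := by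
  unfold sum
  simp only [mul_add, ← FormalSum.inc_mul]
  congr 1
  · congr 1
    · congr 1; ac_rfl
    · congr 1; ac_rfl
  · congr 1; ac_rfl

end PluckerIndex

namespace MatroidOn

variable {E : Type v} [LinearOrder E] {r : ℕ} (M : MatroidOn E r)

variable {M} in
lemma laurent_hom_ext {A : Type w} [CommGroup A] {f g : M.Laurent →* A}
    (he : f M.laurentEps = g M.laurentEps)
    (hv : ∀ B, f (M.laurentVar B) = g (M.laurentVar B)) : f = g := by
  ext1 ⟨s, e⟩
  have hs : ((s, e) : M.Laurent) = (s, 1) * (1, e) := by simp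
  have h1 : f (s, 1) = g (s, 1) := by
    rcases Int.units_eq_one_or s with rfl | rfl
    · exact (map_one f).trans (map_one g).symm
    · exact he
  have h2 : ∀ e : M.Bases →₀ ℤ, f (1, Multiplicative.ofAdd e) = g (1, Multiplicative.ofAdd e) := by
    intro e
    induction e using Finsupp.induction_linear with
    | zero => exact (map_one f).trans (map_one g).symm
    | add x y hx hy =>
      have hxy : ((1, Multiplicative.ofAdd (x + y)) : M.Laurent) =
        (1, Multiplicative.ofAdd x) * (1, Multiplicative.ofAdd y) := rfl
      rw [hxy, map_mul, map_mul, hx, hy]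
    | single B n =>
      have hB : ((1, Multiplicative.ofAdd (Finsupp.single B n)) : M.Laurent) =
          M.laurentVar B ^ n := by
        ext1
        · simp [laurentVar]
        · rw [laurentVar, Prod.pow_snd, ← ofAdd_zsmul, Finsupp.smul_single, smul_eq_mul, mul_one]
      rw [hB, map_zpow, map_zpow, hv]
  rw [hs, map_mul, map_mul, h1]
  exact congrArg _ (h2 e.toAdd)

/-- The quotient map from the Laurent monomials of degree `0` to the units of the weak universal
pasture. -/
def toUniversal : M.LaurentZero →* M.weakUniversalPasture.Units :=
  QuotientGroup.mk' (Pasteurization.subgroup M.laurentZeroNull)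

lemma map_toUniversal_mem {s : MonoidAlgebra ℕ M.LaurentZero} (hs : s ∈ M.laurentZeroNull) :
    FormalSum.map M.toUniversal s ∈ M.weakUniversalPasture.null :=
  Ideal.mem_map_of_mem _ hs

lemma toUniversal_eps :
    M.toUniversal ⟨M.laurentEps, M.laurentEps_mem⟩ = M.weakUniversalPasture.eps := by
  apply Pasture.eq_eps
  have h := M.map_toUniversal_mem M.one_add_eps_mem_laurentZeroNull
  rwa [map_add, map_one, FormalSum.map_of] at h

variable (B₀ : M.Bases)

open Classical in
/-- The function `J ↦ x_J / x_{B₀}`. -/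
def laurentZeroCoord (J : Set.powersetCard E r) : WithZero M.LaurentZero :=
  if h : M.toMatroid.IsBase (J.1 : Set E) then
    ((⟨M.laurentVar ⟨J.1, h⟩ / M.laurentVar B₀, M.laurentVar_div_mem _ _⟩ : M.LaurentZero) :
      WithZero M.LaurentZero)
  else 0

lemma map_laurentZeroCoord (J : Set.powersetCard E r) :
    WithZero.map' M.LaurentZero.subtype (M.laurentZeroCoord B₀ J) =
      (((M.laurentVar B₀)⁻¹ : M.Laurent) : WithZero M.Laurent) * M.laurentCoord J := by
  unfold laurentZeroCoord laurentCoord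
  split_ifs with h
  · rw [WithZero.map'_coe, ← WithZero.coe_mul, inv_mul_eq_div]; rfl
  · simp

lemma sum_laurentZeroCoord_mem (Q : PluckerIndex E r) :
    Q.sum ⟨M.laurentEps, M.laurentEps_mem⟩ (M.laurentZeroCoord B₀) ∈ M.laurentZeroNull := by
  rw [laurentZeroNull, Ideal.mem_comap, PluckerIndex.map_sum]
  simp only [map_laurentZeroCoord, PluckerIndex.sum_mul_left]
  exact Ideal.mul_mem_left _ _ (Ideal.subset_span (Set.mem_insert_of_mem _ ⟨Q, rfl⟩))

/-- The universal weak Grassmann-Plücker function, normalized at the basis `B₀`. -/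
def univGP : WeakGP M M.weakUniversalPasture where
  toFun J := WithZero.map' M.toUniversal (M.laurentZeroCoord B₀ J)
  support J := by
    rw [map_ne_zero]
    unfold laurentZeroCoord
    split_ifs with h
    · exact ⟨fun _ => h, fun _ => WithZero.coe_ne_zero⟩
    · exact ⟨fun h' => absurd rfl h', fun h' => absurd h' h⟩
  plucker Q := by
    have h := M.map_toUniversal_mem (M.sum_laurentZeroCoord_mem B₀ Q)
    rwa [PluckerIndex.map_sum, toUniversal_eps] at h

lemma univGP_unit (B : M.Bases) : (M.univGP B₀).unit B =
    M.toUniversal ⟨M.laurentVar B / M.laurentVar B₀, M.laurentVar_div_mem _ _⟩ := by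
  apply WeakGP.unit_eq
  change WithZero.map' M.toUniversal (M.laurentZeroCoord B₀ B.toSet) = _
  rw [laurentZeroCoord, dif_pos (show M.toMatroid.IsBase (B.toSet.1 : Set E) from B.2),
    WithZero.map'_coe]
  rfl

/-- The projection `x ↦ x / x_{B₀} ^ deg x` onto the Laurent monomials of degree `0`. -/
def degreeZeroPart : M.Laurent →* M.LaurentZero :=
  (MonoidHom.id M.Laurent / (zpowersHom M.Laurent (M.laurentVar B₀)).comp M.laurentDeg).codRestrict
    M.LaurentZero (by
      intro x
      have h : M.laurentDeg (M.laurentVar B₀) = Multiplicative.ofAdd 1 := by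
        simp [laurentDeg, laurentVar]
      simp only [MonoidHom.mem_ker, MonoidHom.div_apply, MonoidHom.id_apply, MonoidHom.comp_apply,
        zpowersHom_apply, map_div, map_zpow, h, ← ofAdd_zsmul, smul_eq_mul, mul_one, ofAdd_toAdd,
        div_self'])

/-- Both homomorphisms fix the meaning of `ε` and send `x_B` to the class of `x_B / x_{B₀}`. On
monomials of degree `0` the projection does nothing, so the evaluation extends the quotient map. -/
lemma univGP_evalHom : (M.univGP B₀).evalHom = M.toUniversal.comp (M.degreeZeroPart B₀) := by
  refine laurent_hom_ext ?_ fun B => ?_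
  · rw [WeakGP.evalHom_eps, ← toUniversal_eps, MonoidHom.comp_apply]
    congr 1
    apply Subtype.ext
    simp [degreeZeroPart, laurentDeg, laurentEps]
  · rw [WeakGP.evalHom_var, univGP_unit, MonoidHom.comp_apply]
    congr 1
    apply Subtype.ext
    simp [degreeZeroPart, laurentDeg, laurentVar]

lemma univGP_evalHom_coe (x : M.LaurentZero) : (M.univGP B₀).evalHom x.1 = M.toUniversal x := by
  rw [univGP_evalHom, MonoidHom.comp_apply]
  congr 1
  apply Subtype.ext
  simp [degreeZeroPart, MonoidHom.mem_ker.1 x.2]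

/-- The nullset of the weak universal pasture is generated by `1 + ε` and the 3-term Plücker
relations for the universal weak Grassmann-Plücker function. -/
lemma weakUniversalPasture_null_le {P : Ideal (MonoidAlgebra ℕ M.weakUniversalPasture.Units)}
    (he : 1 + MonoidAlgebra.of ℕ _ M.weakUniversalPasture.eps ∈ P)
    (hQ : ∀ Q : PluckerIndex E r,
      Q.sum M.weakUniversalPasture.eps (M.univGP B₀).toFun ∈ P) :
    M.weakUniversalPasture.null ≤ P := by
  have h : M.laurentNull ≤ P.comap (FormalSum.map (M.univGP B₀).evalHom) := by
    refine Ideal.span_le.2 (Set.insert_subset ?_ ?_)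
    · simpa only [SetLike.mem_coe, Ideal.mem_comap, map_add, map_one, FormalSum.map_of,
        WeakGP.evalHom_eps] using he
    · rintro _ ⟨Q, rfl⟩
      simpa only [SetLike.mem_coe, Ideal.mem_comap, PluckerIndex.map_sum, WeakGP.evalHom_eps,
        WeakGP.evalHom_coord] using hQ Q
  refine Ideal.map_le_iff_le_comap.2 fun s hs => ?_
  have h' := h (Ideal.mem_comap.1 hs)
  rw [Ideal.mem_comap, ← RingHom.comp_apply, FormalSum.map, FormalSum.map,
    ← MonoidAlgebra.mapDomainRingHom_comp] at h'
  -- The containment was proved for monomials of all degrees, where the ideal has explicit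
  -- generators; it is now restricted to degree `0`.
  have hc : (M.univGP B₀).evalHom.comp M.LaurentZero.subtype = M.toUniversal :=
    MonoidHom.ext fun x => M.univGP_evalHom_coe B₀ x
  rw [hc] at h'
  exact h'

/-- The foundation of `M` is generated by `ε` and the cross ratios. -/
lemma foundationUnits_le {K : Subgroup M.weakUniversalPasture.Units}
    (he : M.weakUniversalPasture.eps ∈ K) (hK : ∀ q, (M.univGP B₀).crossRatio q ∈ K) :
    M.weakUniversalPasture.foundationUnits ≤ K := by
  refine Pasture.foundationUnits_le_of_null_le he
    (M.weakUniversalPasture_null_le B₀ ⟨Pasture.one_add_eps _, Or.inr ?_⟩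
      fun Q => (M.univGP B₀).sum_mem_cosetIdeal he hK Q)
  rw [← map_one (MonoidAlgebra.of ℕ _)]
  intro x hx y hy
  simp only [FormalSum.terms_add, FormalSum.terms_of, Multiset.mem_add,
    Multiset.mem_singleton] at hx hy
  rcases hx with rfl | rfl <;> rcases hy with rfl | rfl <;>
    exact div_mem (by first | exact he | exact one_mem _) (by first | exact he | exact one_mem _)

end MatroidOn

/-! ### Cross ratios, rescaling and characteristic morphisms -/

lemma MatroidOn.exists_eq_mul_prod {E : Type v} [LinearOrder E] [Finite E] {r : ℕ}
    {M : MatroidOn E r} {A : Type w} [CommGroup A] (x : M.Bases → A)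
    (hx : ∀ q : CrossRatioIndex M, x ⟨_, q.isBase₁₂⟩ * x ⟨_, q.isBase₃₄⟩ =
      x ⟨_, q.isBase₂₃⟩ * x ⟨_, q.isBase₄₁⟩) :
    ∃ (a : A) (t : E → A), ∀ B, x B = a * ∏ j ∈ B.1, t j := by
  classical
  -- The value `0` off the bases is irrelevant: trivial cross ratios concern bases only.
  let φ : Finset E → Additive A := fun S =>
    if h : M.toMatroid.IsBase (S : Set E) then Additive.ofMul (x ⟨S, h⟩) else 0
  have hφ : M.CrossRatioTrivial φ := by
    intro I a b c d hI h1 h2 h3 h4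
    simp only [φ, dif_pos h1, dif_pos h2, dif_pos h3, dif_pos h4]
    exact hx ⟨I, hI, a, b, c, d, h1, h2, h3, h4⟩
  obtain ⟨a, t, h⟩ := hφ.exists_eq_add_sum
  refine ⟨a.toMul, fun j => (t j).toMul, fun B => ?_⟩
  have hB := h B.1 B.2
  simp only [φ, dif_pos B.2] at hB
  exact hB

namespace WeakGP

variable {E : Type v} [LinearOrder E] {r : ℕ} {M : MatroidOn E r} {F : Pasture.{u}}
  {F' : Pasture.{w}}

lemma ext_unit {Δ Δ' : WeakGP M F} (h : ∀ B, Δ.unit B = Δ'.unit B) : Δ = Δ' := by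
  ext1; funext J
  by_cases hJ : M.toMatroid.IsBase (J.1 : Set E)
  · exact (Δ.coe_unit ⟨J.1, hJ⟩).symm.trans ((congrArg _ (h _)).trans (Δ'.coe_unit ⟨J.1, hJ⟩))
  · rw [not_not.1 ((Δ.support J).not.2 hJ), not_not.1 ((Δ'.support J).not.2 hJ)]

lemma rescale_unit (a : F.Units) (t : E → F.Units) (Δ : WeakGP M F) (B : M.Bases) :
    (Δ.rescale a t).unit B = a * (∏ j ∈ B.1, t j) * Δ.unit B :=
  unit_eq _ _ (by rw [WithZero.coe_mul, coe_unit]; rfl)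

lemma push_unit (f : Pasture.Hom F F') (Δ : WeakGP M F) (B : M.Bases) :
    (Δ.push f).unit B = f.onUnits (Δ.unit B) :=
  unit_eq _ _ (by
    change f.app (Δ.toFun B.toSet) = _
    rw [← coe_unit, Pasture.Hom.app, WithZero.map'_coe])

lemma rescalingEquivalent_rescale (a : F.Units) (t : E → F.Units) (Δ : WeakGP M F) :
    (Δ.rescale a t).RescalingEquivalent Δ := by
  refine ⟨t, Quotient.sound ⟨a⁻¹, ext_unit fun B => ?_⟩⟩
  simp only [torus, scale, rescale_unit, Pi.one_apply, Finset.prod_const_one]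
  group

lemma RescalingEquivalent.exists_rescale {Δ Δ' : WeakGP M F} (h : Δ.RescalingEquivalent Δ') :
    ∃ a t, Δ' = Δ.rescale a t := by
  obtain ⟨t, ht⟩ := h
  obtain ⟨a, ha⟩ := Quotient.exact ht
  refine ⟨a, t⁻¹, ext_unit fun B => ?_⟩
  have hB := congrArg (fun D : WeakGP M F => D.unit B) ha
  simp only [torus, scale, rescale_unit, Pi.one_apply, Finset.prod_const_one, one_mul,
    mul_one] at hB
  simp only [rescale_unit, Pi.inv_apply, Finset.prod_inv_distrib]
  rw [mul_right_comm, ← hB]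
  simp

/-- Numerator and denominator acquire the same factor: each contains `a` and the product over `I`
twice, and each of the four elements once. -/
lemma crossRatio_rescale (a : F.Units) (t : E → F.Units) (Δ : WeakGP M F) :
    (Δ.rescale a t).crossRatio = Δ.crossRatio := by
  funext q
  have h : ∀ x y, M.toMatroid.IsBase ((q.I ∪ {x, y} : Finset E) : Set E) →
      ∏ j ∈ q.I ∪ {x, y}, t j = (∏ j ∈ q.I, t j) * (t x * t y) := by
    intro x y hxy
    obtain ⟨hne, hx, hy⟩ := MatroidOn.disjoint_pair_of_isBase q.card_add_two hxy
    rw [Finset.prod_union (by simp [hx, hy]), Finset.prod_pair hne]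
  simp only [crossRatio, rescale_unit, h _ _ q.isBase₁₂, h _ _ q.isBase₂₃, h _ _ q.isBase₃₄,
    h _ _ q.isBase₄₁]
  generalize Δ.unit _ = x₁
  generalize Δ.unit _ = x₂
  generalize Δ.unit _ = x₃
  generalize Δ.unit _ = x₄
  generalize ∏ j ∈ q.I, t j = p
  rw [← mul_div_mul_left_eq_div (x₁ * x₂) (x₃ * x₄)
    (a * a * p * p * (t q.i₁ * t q.i₂ * t q.i₃ * t q.i₄))]
  congr 1 <;> ac_rfl

/-- The quotient `Δ / Δ'` has trivial cross ratios, so it comes from a scalar and the torus. -/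
lemma rescalingEquivalent_of_crossRatio_eq [Finite E] {Δ Δ' : WeakGP M F}
    (h : Δ.crossRatio = Δ'.crossRatio) : Δ.RescalingEquivalent Δ' := by
  obtain ⟨a, t, hat⟩ := MatroidOn.exists_eq_mul_prod (fun B => Δ.unit B / Δ'.unit B) (by
    intro q
    have hq := congrFun h q
    rw [crossRatio, crossRatio, div_eq_div_iff_mul_eq_mul] at hq
    rw [div_mul_div_comm, div_mul_div_comm, div_eq_div_iff_mul_eq_mul, hq, mul_comm])
  have : Δ = Δ'.rescale a t := ext_unit fun B => by
    rw [rescale_unit, ← hat, div_mul_cancel]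
  rw [this]
  exact rescalingEquivalent_rescale a t Δ'

lemma charMorphism_toUniversal (Δ : WeakGP M F) (x : M.LaurentZero) :
    Δ.charMorphism.onUnits (M.toUniversal x) = Δ.evalHom x.1 := rfl

/-- Cross ratios have degree `0`, so the normalization at `B₀` cancels. -/
lemma charMorphism_crossRatio (Δ : WeakGP M F) (B₀ : M.Bases) (q : CrossRatioIndex M) :
    Δ.charMorphism.onUnits ((M.univGP B₀).crossRatio q) = Δ.crossRatio q := by
  have h : ∀ B, Δ.charMorphism.onUnits ((M.univGP B₀).unit B) = Δ.unit B / Δ.unit B₀ := by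
    intro B
    rw [MatroidOn.univGP_unit, charMorphism_toUniversal, map_div, evalHom_var, evalHom_var]
  rw [crossRatio, map_div, map_mul, map_mul, h, h, h, h, div_mul_div_comm, div_mul_div_comm,
    div_div_div_cancel_right]
  rfl

lemma charMorphism_push (f : Pasture.Hom F F') (Δ : WeakGP M F) :
    (Δ.push f).charMorphism = f.comp Δ.charMorphism := by
  have h : (Δ.push f).evalHom = f.onUnits.comp Δ.evalHom := by
    refine MatroidOn.laurent_hom_ext ?_ fun B => ?_
    · rw [MonoidHom.comp_apply, evalHom_eps, evalHom_eps, f.map_eps]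
    · rw [MonoidHom.comp_apply, evalHom_var, evalHom_var, push_unit]
  ext x
  obtain ⟨y, rfl⟩ := QuotientGroup.mk'_surjective _ x
  exact DFunLike.congr_fun h y.1

lemma charMorphism_univGP (B₀ : M.Bases) :
    (M.univGP B₀).charMorphism = Pasture.Hom.id M.weakUniversalPasture := by
  ext x
  obtain ⟨y, rfl⟩ := QuotientGroup.mk'_surjective _ x
  exact M.univGP_evalHom_coe B₀ y

/-- The units on which the two characteristic morphisms agree form a subgroup that contains `ε` and
the universal cross ratios, hence the whole foundation. -/
lemma charMorphismFoundation_eq_of_crossRatio_eq [Finite E] {Δ Δ' : WeakGP M F}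
    (h : Δ.crossRatio = Δ'.crossRatio) : (WeakMatroid.mk Δ).charMorphismFoundation =
      (WeakMatroid.mk Δ').charMorphismFoundation := by
  obtain ⟨B₀⟩ := M.exists_base
  have hK : M.weakUniversalPasture.foundationUnits ≤
      Δ.charMorphism.onUnits.eqLocus Δ'.charMorphism.onUnits := by
    refine M.foundationUnits_le B₀ ?_ fun q => ?_
    · exact Δ.charMorphism.map_eps.trans Δ'.charMorphism.map_eps.symm
    · exact (Δ.charMorphism_crossRatio B₀ q).trans
        ((congrFun h q).trans (Δ'.charMorphism_crossRatio B₀ q).symm)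
  ext x
  exact hK x.2

/-- Each cross ratio is the value of the restricted morphism at a universal cross ratio, which lies
in the foundation. -/
lemma crossRatio_eq_of_charMorphismFoundation_eq [Finite E] {Δ Δ' : WeakGP M F}
    (h : (WeakMatroid.mk Δ).charMorphismFoundation =
      (WeakMatroid.mk Δ').charMorphismFoundation) : Δ.crossRatio = Δ'.crossRatio := by
  obtain ⟨B₀⟩ := M.exists_base
  funext q
  rw [← Δ.charMorphism_crossRatio B₀, ← Δ'.charMorphism_crossRatio B₀]
  exact DFunLike.congr_fun (congrArg Pasture.Hom.onUnits h)
    ⟨_, (M.univGP B₀).crossRatio_mem_foundationUnits q⟩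

lemma RescalingEquivalent.charMorphismFoundation_eq [Finite E] {Δ Δ' : WeakGP M F}
    (h : Δ.RescalingEquivalent Δ') : (WeakMatroid.mk Δ).charMorphismFoundation =
      (WeakMatroid.mk Δ').charMorphismFoundation := by
  obtain ⟨a, t, rfl⟩ := h.exists_rescale
  exact charMorphismFoundation_eq_of_crossRatio_eq (crossRatio_rescale a t Δ).symm

/-- A weak Grassmann-Plücker function whose values are in the foundation of `F` is defined over
the foundation of `F`. -/
lemma exists_push_foundationIncl_eq (Δ : WeakGP M F) (h : ∀ B, Δ.unit B ∈ F.foundationUnits) :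
    ∃ Δ₀ : WeakGP M F.foundation, Δ₀.push F.foundationIncl = Δ := by
  classical
  let k : M.Bases → F.foundation.Units := fun B => ⟨Δ.unit B, h B⟩
  let g : Set.powersetCard E r → F.foundation.Elem := fun J =>
    if hJ : M.toMatroid.IsBase (J.1 : Set E) then (k ⟨J.1, hJ⟩ : F.foundation.Elem) else 0
  have hg : ∀ J, WithZero.map' F.foundationIncl.onUnits (g J) = Δ.toFun J := by
    intro J
    by_cases hJ : M.toMatroid.IsBase (J.1 : Set E)
    · rw [show g J = k ⟨J.1, hJ⟩ from dif_pos hJ]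
      exact Δ.coe_unit ⟨J.1, hJ⟩
    · rw [show g J = 0 from dif_neg hJ, map_zero, not_not.1 ((Δ.support J).not.2 hJ)]
  refine ⟨⟨g, fun J => ?_, fun Q => ?_⟩, ?_⟩
  · rw [← Δ.support J, ← hg J, map_ne_zero]
  · change FormalSum.map F.foundationIncl.onUnits (Q.sum F.foundation.eps g) ∈ F.null
    rw [PluckerIndex.map_sum, F.foundationIncl.map_eps]
    simp only [hg]
    exact Δ.plucker Q
  · ext1; funext J
    exact hg J

end WeakGP

/-! ### The universal rescaling class over the foundation -/

namespace MatroidOn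

variable {E : Type v} [LinearOrder E] [Finite E] {r : ℕ} (M : MatroidOn E r)

/-- There is a weak Grassmann-Plücker function over the foundation of `M` whose characteristic
morphism restricts to the identity. -/
lemma exists_charMorphism_comp_incl_eq_id : ∃ Δ : WeakGP M M.foundation,
    Δ.charMorphism.comp M.weakUniversalPasture.foundationIncl = Pasture.Hom.id M.foundation := by
  obtain ⟨B₀⟩ := M.exists_base
  let K := M.weakUniversalPasture.foundationUnits
  -- Modulo the units of the foundation, the cross ratios of the universal function become trivial.
  obtain ⟨a, t, hat⟩ := MatroidOn.exists_eq_mul_prod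
    (fun B => QuotientGroup.mk' K ((M.univGP B₀).unit B)) (by
      intro q
      have h := (QuotientGroup.eq_one_iff _).2 ((M.univGP B₀).crossRatio_mem_foundationUnits q)
      rw [WeakGP.crossRatio, QuotientGroup.mk_div, div_eq_one] at h
      exact h)
  obtain ⟨a, rfl⟩ := QuotientGroup.mk'_surjective K a
  choose s hs using fun j => QuotientGroup.mk'_surjective K (t j)
  -- Undoing the scalar and the torus element by lifts makes every value trivial modulo `K`, so the
  -- rescaled function descends to the foundation.
  obtain ⟨Δ, hΔ⟩ := ((M.univGP B₀).rescale a⁻¹ s⁻¹).exists_push_foundationIncl_eq (by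
    intro B
    rw [← QuotientGroup.eq_one_iff]
    change QuotientGroup.mk' K _ = 1
    rw [WeakGP.rescale_unit, map_mul, hat, map_mul, map_prod]
    simp only [Pi.inv_apply, map_inv, hs, Finset.prod_inv_distrib]
    rw [← mul_inv, inv_mul_cancel])
  refine ⟨Δ, ?_⟩
  -- Rescaling does not change the restricted characteristic morphism, and for the universal
  -- function this is the inclusion of the foundation. Injectivity of the inclusion then leaves the
  -- identity.
  have h := (WeakGP.rescalingEquivalent_rescale a⁻¹ s⁻¹
    (M.univGP B₀)).charMorphismFoundation_eq
  rw [← hΔ] at h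
  change (Δ.push M.weakUniversalPasture.foundationIncl).charMorphism.comp _ =
    (M.univGP B₀).charMorphism.comp _ at h
  rw [WeakGP.charMorphism_push, WeakGP.charMorphism_univGP] at h
  exact Pasture.Hom.ext (MonoidHom.ext fun x =>
    Subtype.ext (DFunLike.congr_fun (congrArg Pasture.Hom.onUnits h) x))

end MatroidOn

/-- The map from rescaling classes to morphisms from the foundation. -/
def RescalingClass.charMorphismFoundation {E : Type v} [LinearOrder E] [Finite E] {r : ℕ}
    {M : MatroidOn E r} {F : Pasture.{u}} : RescalingClass M F → Pasture.Hom M.foundation F :=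
  Quotient.lift WeakMatroid.charMorphismFoundation (by
    rintro ⟨Δ⟩ ⟨Δ'⟩ h
    exact WeakGP.RescalingEquivalent.charMorphismFoundation_eq h)

end

theorem mainTheorem8 {E : Type v} [LinearOrder E] [Finite E] {r : ℕ} (M : MatroidOn E r) :
    (∀ (F : Pasture.{u}) (Δ Δ' : WeakGP M F),
      List.TFAE [
        Δ.RescalingEquivalent Δ',
        Δ.crossRatio = Δ'.crossRatio,
        (WeakMatroid.mk Δ).charMorphismFoundation = (WeakMatroid.mk Δ').charMorphismFoundation]) ∧
    ∃ Φ : ∀ F : Pasture.{u}, RescalingClass M F → Pasture.Hom M.foundation F,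
      (∀ (F : Pasture.{u}) (Δ : WeakGP M F),
        Φ F (RescalingClass.mk (WeakMatroid.mk Δ)) =
          (WeakMatroid.mk Δ).charMorphismFoundation) ∧
      (∀ F : Pasture.{u}, Function.Bijective (Φ F)) ∧
      ∀ (F F' : Pasture.{u}) (f : Pasture.Hom F F') (c : RescalingClass M F),
        Φ F' (RescalingClass.push f c) = f.comp (Φ F c) := by
  refine ⟨fun F Δ Δ' => ?_, fun F => RescalingClass.charMorphismFoundation, fun F Δ => rfl,
    fun F => ⟨?_, fun f => ?_⟩, ?_⟩
  · tfae_have 1 → 3 := WeakGP.RescalingEquivalent.charMorphismFoundation_eq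
    tfae_have 3 → 2 := WeakGP.crossRatio_eq_of_charMorphismFoundation_eq
    tfae_have 2 → 1 := WeakGP.rescalingEquivalent_of_crossRatio_eq
    tfae_finish
  · rintro ⟨⟨Δ⟩⟩ ⟨⟨Δ'⟩⟩ h
    exact Quotient.sound (WeakGP.rescalingEquivalent_of_crossRatio_eq
      (WeakGP.crossRatio_eq_of_charMorphismFoundation_eq h))
  -- A preimage of `f` is the pushforward along `f` of the universal class over the foundation.
  · obtain ⟨Δ, hΔ⟩ := M.exists_charMorphism_comp_incl_eq_id
    refine ⟨RescalingClass.mk (WeakMatroid.mk (Δ.push f)), ?_⟩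
    change (Δ.push f).charMorphism.comp M.weakUniversalPasture.foundationIncl = f
    rw [WeakGP.charMorphism_push]
    change f.comp (Δ.charMorphism.comp M.weakUniversalPasture.foundationIncl) = f
    rw [hΔ]
    rfl
  · rintro F F' f ⟨⟨Δ⟩⟩
    change (Δ.push f).charMorphism.comp M.weakUniversalPasture.foundationIncl = _
    rw [WeakGP.charMorphism_push]
    rfl
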